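/- Let $\sigma_1=\begin{pmatrix}0&1\\1&0\end{pmatrix}$, $\sigma_2=\begin{pmatrix}0&-i\\i&0\end{pmatrix}$, $\sigma_3=\begin{pmatrix}1&0\\0&-1\end{pmatrix}$ be the Pauli matrices, $\alpha_j=\begin{pmatrix}0&\sigma_j\\\sigma_j&0\end{pmatrix}$ for $j=1,2,3$, and $-i\alpha\cdot\nabla\psi=-i\sum_{j=1}^3\alpha_j\partial_j\psi$ for $\psi:\mathbb{R}^3\to\mathbb{C}^4$. Let $R>0$. Then for every $\psi\in C_c^\infty(\mathbb{R}^3)^4$ the three integrals below are finite and $$\int_{\mathbb{R}^3}|x|\,|-i\alpha\cdot\nabla\psi(x)|^2\,dx\;\ge\;\int_{\mathbb{R}^3}\frac{|\psi(x)|^2}{|x|}\,dx+\frac14\int_{\mathbb{R}^3}\frac{\left|\psi(x)-\frac{R}{|x|}\psi\!\left(R\frac{x}{|x|}\right)\right|^2}{|x|\log^2(|x|/R)}\,dx .$$ Moreover, the inequality is sharp, in the sense that its constants are optimal: if $a,b\in\mathbb{R}$ are such that $$\int_{\mathbb{R}^3}|x|\,|-i\alpha\cdot\nabla\psi(x)|^2\,dx\;\ge\;a\int_{\mathbb{R}^3}\frac{|\psi(x)|^2}{|x|}\,dx+b\int_{\mathbb{R}^3}\frac{\left|\psi(x)-\frac{R}{|x|}\psi\!\left(R\frac{x}{|x|}\right)\right|^2}{|x|\log^2(|x|/R)}\,dx$$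 for all $\psi\in C_c^\infty(\mathbb{R}^3)^4$, then $a\le 1$ and $b\le\frac14$. -/

import Mathlib

open MeasureTheory
open scoped ContDiff

/-- Physical space `ℝ³` with the Euclidean norm. -/
abbrev Space3 : Type := EuclideanSpace ℝ (Fin 3)

/-- The space `ℂ⁴` of spinors with the Hermitian norm. -/
abbrev Spinor : Type := EuclideanSpace ℂ (Fin 4)

/-- The Pauli matrices `σ₁, σ₂, σ₃`. -/
def pauli : Fin 3 → Matrix (Fin 2) (Fin 2) ℂ :=
  ![!![0, 1; 1, 0], !![0, -Complex.I; Complex.I, 0], !![1, 0; 0, -1]]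

/-- The Dirac matrices `αⱼ`, with `2 × 2` blocks `0, σⱼ; σⱼ, 0`. -/
def diracAlpha (j : Fin 3) : Matrix (Fin 4) (Fin 4) ℂ :=
  Matrix.reindex finSumFinEquiv finSumFinEquiv
    (Matrix.fromBlocks 0 (pauli j) (pauli j) 0 : Matrix (Fin 2 ⊕ Fin 2) (Fin 2 ⊕ Fin 2) ℂ)

/-- The partial derivative `∂ⱼψ(x)`. -/
noncomputable def partialD (j : Fin 3) (ψ : Space3 → Spinor) (x : Space3) : Spinor :=
  fderiv ℝ ψ x (EuclideanSpace.single j (1 : ℝ))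

/-- The massless free Dirac operator: `(-i α·∇ψ)(x) = ∑ⱼ -i αⱼ ∂ⱼψ(x)`. -/
noncomputable def diracOp (ψ : Space3 → Spinor) (x : Space3) : Spinor :=
  ∑ j : Fin 3, (-Complex.I) • WithLp.toLp 2 ((diracAlpha j).mulVec (partialD j ψ x).ofLp)

/-- `ψ ∈ C_c^∞(ℝ³)⁴`. -/
def IsTestSpinor (ψ : Space3 → Spinor) : Prop :=
  ContDiff ℝ ∞ ψ ∧ HasCompactSupport ψ

/-- The integrand `|x| |-iα·∇ψ(x)|²`. -/
noncomputable def kineticDensity (ψ : Space3 → Spinor) (x : Space3) : ℝ :=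
  ‖x‖ * ‖diracOp ψ x‖ ^ 2

/-- The integrand `|ψ(x)|² / |x|`. -/
noncomputable def coulombDensity (ψ : Space3 → Spinor) (x : Space3) : ℝ :=
  ‖ψ x‖ ^ 2 / ‖x‖

/-- The integrand `|ψ(x) - (R/|x|) ψ(R x/|x|)|² / (|x| log²(|x|/R))`; the value on the null set
`x = 0` or `|x| = R` is irrelevant. -/
noncomputable def logDensity (R : ℝ) (ψ : Space3 → Spinor) (x : Space3) : ℝ :=
  ‖ψ x - (R / ‖x‖) • ψ ((R / ‖x‖) • x)‖ ^ 2 / (‖x‖ * Real.log (‖x‖ / R) ^ 2)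

/-! Write `L_l` for the angular derivative about axis `l` and `B_l` for the antisymmetric real form
`spinForm l`. Since the Dirac matrices are self-adjoint, anticommute and square to 1, `|Dψ|²` is
`|∇ψ|²` plus the terms `2 B_l(∂_{l+1}ψ, ∂_{l+2}ψ)`. With the weight `|x|`, the gradient splits into
radial and angular parts (`norm_mul_sum_norm_sq_partialD`), while integration by parts turns each
spin term into `-∫ B_l(ψ, L_lψ)/|x|` (`IsTestSpinor.integral_norm_mul_spinForm`). Hence the kinetic
integral is `∫ |x·∇ψ|²/|x|` plus the sum over the three axes of `∫ (|L_lψ|² - B_l(ψ, L_lψ))/|x|`. On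
every circle about axis `l` the last integrand has nonnegative mean by Wirtinger's inequality
(`integral_spinForm_deriv_le`), so the radial part is a lower bound, without any expansion in
spherical spinors.

The radial part is treated ray by ray. For `χ(r) = ψ(rξ)` and `φ = rχ`, the integral of `r³|χ'|²` is
that of `r|φ'|²` plus that of `r|χ|²`. The second piece is the Coulomb term; the first dominates the
logarithmic term by Hardy's inequality in the variable `log r`, applied to `φ - φ(R)`
(`log_hardy_Ioi`).

For optimality, the spinors `φ(log(|x|/R))/|x|` times a fixed vector reduce the three integrals, up
to the area of the sphere, to `∫ φ'² + ∫ φ²`, `∫ φ²` and, if `φ(0) = 0`, `∫ φ²/t²`. Wide dilations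
of a bump make `∫ φ²` dominate and force `a ≤ 1`; truncations of `√t` close to `t = 0` make `∫ φ'²`
and `∫ φ²/t²` dominate with ratio tending to 1/4, and force `b ≤ 1/4`. -/

/-! ### Algebra of the Dirac matrices -/

/-- The Dirac matrix `αⱼ` acting on spinors. -/
noncomputable def alphaCLM (j : Fin 3) : Spinor →L[ℂ] Spinor :=
  Matrix.toEuclideanCLM (𝕜 := ℂ) (diracAlpha j)

theorem star_diracAlpha (j : Fin 3) : star (diracAlpha j) = diracAlpha j := by
  have h : (pauli j).conjTranspose = pauli j := by
    ext a b
    fin_cases j <;> fin_cases a <;> fin_cases b <;> simp [pauli]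
  rw [diracAlpha, Matrix.star_eq_conjTranspose, Matrix.conjTranspose_reindex,
    Matrix.fromBlocks_conjTranspose, h, Matrix.conjTranspose_zero]

theorem diracAlpha_mul_self (j : Fin 3) : diracAlpha j * diracAlpha j = 1 := by
  have h : pauli j * pauli j = 1 := by
    ext a b
    fin_cases j <;> fin_cases a <;> fin_cases b <;> simp [pauli, Matrix.mul_apply]
  rw [diracAlpha, Matrix.reindex_apply, Matrix.submatrix_mul_equiv, Matrix.fromBlocks_multiply]
  simp [h, Matrix.fromBlocks_one]

theorem diracAlpha_mul_comm {j k : Fin 3} (hjk : j ≠ k) :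
    diracAlpha j * diracAlpha k = -(diracAlpha k * diracAlpha j) := by
  have h : pauli j * pauli k = -(pauli k * pauli j) := by
    ext a b
    fin_cases j <;> fin_cases k <;> first | exact absurd rfl hjk | skip
    all_goals fin_cases a <;> fin_cases b <;> simp [pauli, Matrix.mul_apply]
  simp only [diracAlpha, Matrix.reindex_apply, Matrix.submatrix_mul_equiv,
    Matrix.fromBlocks_multiply, h]
  ext a b
  rw [Matrix.neg_apply, Matrix.submatrix_apply, Matrix.submatrix_apply, ← Matrix.neg_apply,
    Matrix.fromBlocks_neg]
  simp

theorem star_alphaCLM (j : Fin 3) : star (alphaCLM j) = alphaCLM j := by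
  rw [alphaCLM, ← map_star, star_diracAlpha]

theorem alphaCLM_apply_self (j : Fin 3) (p : Spinor) : alphaCLM j (alphaCLM j p) = p := by
  rw [← mul_apply_eq_comp, alphaCLM, ← map_mul, diracAlpha_mul_self, map_one]
  rfl

theorem alphaCLM_apply_comm {j k : Fin 3} (hjk : j ≠ k) (p : Spinor) :
    alphaCLM j (alphaCLM k p) = -alphaCLM k (alphaCLM j p) := by
  rw [← mul_apply_eq_comp, ← mul_apply_eq_comp, alphaCLM, alphaCLM,
    ← map_mul, ← map_mul, diracAlpha_mul_comm hjk, map_neg]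
  rfl

theorem inner_alphaCLM_left (j : Fin 3) (p q : Spinor) :
    inner ℂ (alphaCLM j p) q = inner ℂ p (alphaCLM j q) := by
  rw [← ContinuousLinearMap.adjoint_inner_right, ← ContinuousLinearMap.star_eq_adjoint,
    star_alphaCLM]

theorem norm_alphaCLM (j : Fin 3) (p : Spinor) : ‖alphaCLM j p‖ = ‖p‖ := by
  have h : ‖alphaCLM j p‖ ^ 2 = ‖p‖ ^ 2 := by
    rw [← inner_self_eq_norm_sq (𝕜 := ℂ), ← inner_self_eq_norm_sq (𝕜 := ℂ), inner_alphaCLM_left,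
      alphaCLM_apply_self]
  exact (sq_eq_sq₀ (norm_nonneg _) (norm_nonneg _)).1 h

/-- The real bilinear form `(p, q) ↦ Re ⟨p, α_{l+1} α_{l+2} q⟩`, where
`α_{l+1} α_{l+2} = i Σ_l` with `Σ_l` the spin matrix. -/
noncomputable def spinForm (l : Fin 3) (p q : Spinor) : ℝ :=
  (inner ℂ p (alphaCLM (l + 1) (alphaCLM (l + 2) q))).re

/-- The product of two anticommuting self-adjoint matrices is skew-adjoint. -/
theorem spinForm_antisymm (l : Fin 3) (p q : Spinor) : spinForm l p q = -spinForm l q p := by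
  have hl : l + 1 ≠ l + 2 := by fin_cases l <;> decide
  rw [spinForm, spinForm, alphaCLM_apply_comm hl, inner_neg_right, Complex.neg_re,
    ← inner_alphaCLM_left, ← inner_alphaCLM_left, ← inner_conj_symm, Complex.conj_re]

theorem spinForm_self (l : Fin 3) (p : Spinor) : spinForm l p p = 0 := by
  have := spinForm_antisymm l p p
  linarith

theorem abs_spinForm_le (l : Fin 3) (p q : Spinor) : |spinForm l p q| ≤ ‖p‖ * ‖q‖ := by
  refine (Complex.abs_re_le_norm _).trans ((norm_inner_le_norm _ _).trans ?_)
  rw [norm_alphaCLM, norm_alphaCLM]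

theorem spinForm_add_right (l : Fin 3) (p q q' : Spinor) :
    spinForm l p (q + q') = spinForm l p q + spinForm l p q' := by
  simp [spinForm]

theorem spinForm_sub_right (l : Fin 3) (p q q' : Spinor) :
    spinForm l p (q - q') = spinForm l p q - spinForm l p q' := by
  simp [spinForm]

theorem spinForm_sub_left (l : Fin 3) (p p' q : Spinor) :
    spinForm l (p - p') q = spinForm l p q - spinForm l p' q := by
  simp [spinForm]

theorem spinForm_smul_right (l : Fin 3) (c : ℝ) (p q : Spinor) :
    spinForm l p (c • q) = c * spinForm l p q := by
  rw [← Complex.coe_smul c q, spinForm, map_smul, map_smul, inner_smul_right, Complex.re_ofReal_mul,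
    spinForm]

theorem spinForm_smul_left (l : Fin 3) (c : ℝ) (p q : Spinor) :
    spinForm l (c • p) q = c * spinForm l p q := by
  rw [spinForm_antisymm, spinForm_smul_right, spinForm_antisymm l q p]; ring

/-- The real bilinear form `spinForm l` as a continuous bilinear map. -/
noncomputable def spinFormCLM (l : Fin 3) : Spinor →L[ℝ] Spinor →L[ℝ] ℝ :=
  LinearMap.mkContinuous₂
    (LinearMap.mk₂ ℝ (spinForm l)
      (fun p p' q => by simp [spinForm])
      (fun c p q => spinForm_smul_left l c p q)
      (fun p q q' => spinForm_add_right l p q q')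
      (fun c p q => spinForm_smul_right l c p q)) 1
    (fun p q => by rw [one_mul]; exact abs_spinForm_le l p q)

@[simp]
theorem spinFormCLM_apply (l : Fin 3) (p q : Spinor) : spinFormCLM l p q = spinForm l p q := rfl

theorem continuous_spinForm (l : Fin 3) {X : Type*} [TopologicalSpace X] {f g : X → Spinor}
    (hf : Continuous f) (hg : Continuous g) : Continuous fun x => spinForm l (f x) (g x) :=
  (((spinFormCLM l).continuous.comp hf).clm_apply hg)

/-- Each `αⱼ` is an isometry, which gives the diagonal terms. The indices `l + 1`, `l + 2` are taken
mod 3, so the pair (0, 2) has to be conjugated into the cyclic order (2, 0). -/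
theorem norm_sq_diracOp (ψ : Space3 → Spinor) (x : Space3) :
    ‖diracOp ψ x‖ ^ 2 = ∑ j, ‖partialD j ψ x‖ ^ 2 +
      2 * ∑ l : Fin 3, spinForm l (partialD (l + 1) ψ x) (partialD (l + 2) ψ x) := by
  have h : diracOp ψ x = (-Complex.I) • ∑ j, alphaCLM j (partialD j ψ x) := by
    rw [diracOp, Finset.smul_sum]
    rfl
  have key : ∀ j k : Fin 3, ∀ p q : Spinor,
      inner ℂ (alphaCLM j p) (alphaCLM k q) = inner ℂ p (alphaCLM j (alphaCLM k q)) :=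
    fun j k p q => inner_alphaCLM_left _ _ _
  rw [h, norm_smul, norm_neg, Complex.norm_I, one_mul, Fin.sum_univ_three, Fin.sum_univ_three,
    Fin.sum_univ_three, @norm_add_sq ℂ, @norm_add_sq ℂ, inner_add_left, norm_alphaCLM,
    norm_alphaCLM, norm_alphaCLM, key]
  have h20 : RCLike.re (inner ℂ (alphaCLM 0 (partialD 0 ψ x)) (alphaCLM 2 (partialD 2 ψ x)))
      = spinForm 1 (partialD 2 ψ x) (partialD 0 ψ x) := by
    rw [← inner_conj_symm, key]
    exact Complex.conj_re _
  have h01 : RCLike.re (inner ℂ (partialD 0 ψ x) (alphaCLM 0 (alphaCLM 1 (partialD 1 ψ x))))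
      = spinForm 2 (partialD 0 ψ x) (partialD 1 ψ x) := rfl
  have h12 : RCLike.re (inner ℂ (partialD 1 ψ x) (alphaCLM 1 (alphaCLM 2 (partialD 2 ψ x))))
      = spinForm 0 (partialD 1 ψ x) (partialD 2 ψ x) := rfl
  rw [map_add, h20, key, h01, h12]
  change _ = _ + 2 * (spinForm 0 (partialD 1 ψ x) (partialD 2 ψ x) +
    spinForm 1 (partialD 2 ψ x) (partialD 0 ψ x) + spinForm 2 (partialD 0 ψ x) (partialD 1 ψ x))
  ring

/-- The angular derivative about the `l`-th axis, `x_{l+1} ∂_{l+2} ψ - x_{l+2} ∂_{l+1} ψ`. -/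
noncomputable def angularD (l : Fin 3) (ψ : Space3 → Spinor) (x : Space3) : Spinor :=
  x (l + 1) • partialD (l + 2) ψ x - x (l + 2) • partialD (l + 1) ψ x

theorem fderiv_apply_eq_sum (ψ : Space3 → Spinor) (x v : Space3) :
    fderiv ℝ ψ x v = ∑ j, v j • partialD j ψ x := by
  have hv : v = ∑ j, v j • EuclideanSpace.single j (1 : ℝ) := by
    ext i
    fin_cases i <;> simp [Fin.sum_univ_three]
  conv_lhs => rw [hv]
  rw [map_sum]
  simp [partialD]

/-- Lagrange's identity `|x|²|∇ψ|² = |x·∇ψ|² + |x×∇ψ|²`, divided by `|x|`. -/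
theorem norm_mul_sum_norm_sq_partialD (ψ : Space3 → Spinor) (x : Space3) :
    ‖x‖ * ∑ j, ‖partialD j ψ x‖ ^ 2 =
      ‖x‖⁻¹ * ‖fderiv ℝ ψ x x‖ ^ 2 + ∑ l, ‖x‖⁻¹ * ‖angularD l ψ x‖ ^ 2 := by
  have key : ‖x‖ ^ 2 * ∑ j, ‖partialD j ψ x‖ ^ 2 =
      ‖fderiv ℝ ψ x x‖ ^ 2 + ∑ l, ‖angularD l ψ x‖ ^ 2 := by
    rw [fderiv_apply_eq_sum, EuclideanSpace.real_norm_sq_eq]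
    simp only [Fin.sum_univ_three, angularD]
    have e1 : (0 : Fin 3) + 1 = 1 := rfl
    have e2 : (0 : Fin 3) + 2 = 2 := rfl
    have e3 : (1 : Fin 3) + 1 = 2 := rfl
    have e4 : (1 : Fin 3) + 2 = 0 := rfl
    have e5 : (2 : Fin 3) + 1 = 0 := rfl
    have e6 : (2 : Fin 3) + 2 = 1 := rfl
    simp only [e1, e2, e3, e4, e5, e6, @norm_add_sq_real, @norm_sub_sq_real, norm_smul,
      inner_add_left, inner_smul_left, inner_smul_right, mul_pow, Real.norm_eq_abs, sq_abs,
      conj_trivial, real_inner_comm (partialD 0 ψ x) (partialD 1 ψ x),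
      real_inner_comm (partialD 1 ψ x) (partialD 2 ψ x)]
    ring
  rcases eq_or_ne x 0 with rfl | hx
  · simp
  have hx' : ‖x‖ ≠ 0 := norm_ne_zero_iff.2 hx
  rw [← Finset.mul_sum, ← mul_add, ← key]
  field_simp

/-! ### Wirtinger's inequality on the circle -/

/-- By Parseval it suffices to compare Fourier coefficients: differentiation multiplies the `n`-th
one by `i n`, with `|n| ≥ 1` for `n ≠ 0`, and subtracting the mean removes `n = 0`. The period `2π`
makes the constant 1. -/
theorem integral_norm_sq_sub_mean_le {f f' : ℝ → ℂ} (hf : ∀ x, HasDerivAt f (f' x) x)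
    (hf' : Continuous f') (hper : f (2 * Real.pi) = f 0) :
    ∫ x in (0)..(2 * Real.pi), ‖f x - (2 * Real.pi)⁻¹ • ∫ y in (0)..(2 * Real.pi), f y‖ ^ 2 ≤
      ∫ x in (0)..(2 * Real.pi), ‖f' x‖ ^ 2 := by
  have hab : (0 : ℝ) < 2 * Real.pi := Real.two_pi_pos
  set m : ℂ := (2 * Real.pi)⁻¹ • ∫ y in (0)..(2 * Real.pi), f y with hm
  have hfc : Continuous f := continuous_iff_continuousAt.2 fun x => (hf x).continuousAt
  have hgc : Continuous fun x => f x - m := hfc.sub continuous_const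
  have hL2 : ∀ g : ℝ → ℂ, Continuous g →
      MemLp g 2 (volume.restrict (Set.Ioc 0 (2 * Real.pi))) := fun g hg =>
    (memLp_two_iff_integrable_sq_norm hg.aestronglyMeasurable).2 (hg.norm.pow 2).integrableOn_Ioc
  have h1 := hasSum_sq_fourierCoeffOn hab (hL2 _ hgc)
  have h2 := hasSum_sq_fourierCoeffOn hab (hL2 _ hf')
  have hle : ∀ n : ℤ, ‖fourierCoeffOn hab (fun x => f x - m) n‖ ^ 2 ≤
      ‖fourierCoeffOn hab f' n‖ ^ 2 := by
    intro n
    rcases eq_or_ne n 0 with rfl | hn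
    · have : fourierCoeffOn hab (fun x => f x - m) 0 = 0 := by
        rw [fourierCoeffOn_eq_integral]
        simp only [neg_zero, fourier_zero, one_smul]
        rw [intervalIntegral.integral_sub (hfc.intervalIntegrable _ _)
          (continuous_const.intervalIntegrable _ _), intervalIntegral.integral_const, hm,
          smul_smul, sub_zero, mul_inv_cancel₀ hab.ne', one_smul, sub_self, smul_zero]
      rw [this]
      simp
    · rw [fourierCoeffOn_of_hasDerivAt hab hn (fun x _ => (hf x).sub_const m)
        (hf'.intervalIntegrable _ _), hper]
      have hn1 : (1 : ℝ) ≤ |(n : ℝ)| := by exact_mod_cast Int.one_le_abs hn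
      have hpi := Real.pi_pos
      rw [sub_self, mul_zero, zero_sub, norm_mul, mul_pow, norm_neg, norm_mul]
      have e1 : ‖(1 : ℂ) / (-2 * Real.pi * Complex.I * n)‖ = (2 * Real.pi * |(n : ℝ)|)⁻¹ := by
        simp [abs_of_pos hpi]
      have e2 : ‖((2 * Real.pi : ℝ) : ℂ) - ((0 : ℝ) : ℂ)‖ = 2 * Real.pi := by
        rw [Complex.ofReal_zero, sub_zero, Complex.norm_real, Real.norm_of_nonneg hab.le]
      rw [e1, e2, ← mul_pow, ← mul_assoc]
      gcongr
      refine mul_le_of_le_one_left (norm_nonneg _) ?_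
      rw [mul_inv, mul_comm, ← mul_assoc, mul_inv_cancel₀ hab.ne', one_mul]
      exact inv_le_one_of_one_le₀ hn1
  have h3 := hasSum_le hle h1 h2
  simp only [smul_eq_mul, sub_zero] at h3
  exact le_of_mul_le_mul_left h3 (by positivity)

theorem Spinor.hasDerivAt_apply {u : ℝ → Spinor} {u' : Spinor} {t : ℝ} (hu : HasDerivAt u u' t)
    (i : Fin 4) : HasDerivAt (fun s => u s i) (u' i) t :=
  (((EuclideanSpace.proj i : Spinor →L[ℂ] ℂ).restrictScalars ℝ).hasFDerivAt
    (x := u t)).comp_hasDerivAt t hu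

/-- As `u'` has mean zero over a period, `u` may be replaced by `u - m`, with `m` its mean. Then
`|B_l(p, q)| ≤ |p||q|`, the arithmetic-geometric mean inequality and Wirtinger conclude. -/
theorem integral_spinForm_deriv_le (l : Fin 3) {u u' : ℝ → Spinor}
    (hu : ∀ t, HasDerivAt u (u' t) t) (hu' : Continuous u') (hper : u (2 * Real.pi) = u 0) :
    ∫ t in (0)..(2 * Real.pi), spinForm l (u t) (u' t) ≤
      ∫ t in (0)..(2 * Real.pi), ‖u' t‖ ^ 2 := by
  have hpi : (0 : ℝ) ≤ 2 * Real.pi := Real.two_pi_pos.le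
  have huc : Continuous u := continuous_iff_continuousAt.2 fun x => (hu x).continuousAt
  set m : Spinor := WithLp.toLp 2 fun i => (2 * Real.pi)⁻¹ • ∫ y in (0)..(2 * Real.pi), u y i
  have hci : ∀ v : ℝ → Spinor, Continuous v → ∀ i, Continuous fun t => v t i :=
    fun v hv i => (EuclideanSpace.proj i : Spinor →L[ℂ] ℂ).continuous.comp hv
  have hwirt : ∫ t in (0)..(2 * Real.pi), ‖u t - m‖ ^ 2 ≤
      ∫ t in (0)..(2 * Real.pi), ‖u' t‖ ^ 2 := by
    simp only [EuclideanSpace.norm_sq_eq]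
    rw [intervalIntegral.integral_finsetSum, intervalIntegral.integral_finsetSum]
    · exact Finset.sum_le_sum fun i _ => integral_norm_sq_sub_mean_le
        (fun t => Spinor.hasDerivAt_apply (hu t) i) (hci u' hu' i) (by rw [hper])
    · exact fun i _ => ((hci u' hu' i).norm.pow 2).intervalIntegrable _ _
    · exact fun i _ => ((hci _ (huc.sub continuous_const) i).norm.pow 2).intervalIntegrable _ _
  have hzero : ∫ t in (0)..(2 * Real.pi), spinForm l m (u' t) = 0 := by
    have h1 := (spinFormCLM l m).intervalIntegral_comp_comm
      (hu'.intervalIntegrable (μ := volume) 0 (2 * Real.pi))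
    rw [intervalIntegral.integral_eq_sub_of_hasDerivAt (fun t _ => hu t)
      (hu'.intervalIntegrable _ _), hper, sub_self, map_zero] at h1
    exact h1
  have hcont : Continuous fun t => spinForm l (u t - m) (u' t) :=
    continuous_spinForm l (huc.sub continuous_const) hu'
  have hsplit : ∫ t in (0)..(2 * Real.pi), spinForm l (u t) (u' t) =
      ∫ t in (0)..(2 * Real.pi), spinForm l (u t - m) (u' t) := by
    simp only [spinForm_sub_left]
    rw [intervalIntegral.integral_sub, hzero, sub_zero]
    · exact (continuous_spinForm l huc hu').intervalIntegrable _ _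
    · exact (continuous_spinForm l continuous_const hu').intervalIntegrable _ _
  have hpt : ∀ t, spinForm l (u t - m) (u' t) ≤ (1 / 2) * ‖u t - m‖ ^ 2 + (1 / 2) * ‖u' t‖ ^ 2 := by
    intro t
    have := (le_abs_self _).trans (abs_spinForm_le l (u t - m) (u' t))
    nlinarith [sq_nonneg (‖u t - m‖ - ‖u' t‖)]
  have hi1 : Continuous fun t => (1 / 2 : ℝ) * ‖u t - m‖ ^ 2 := by fun_prop
  have hi2 : Continuous fun t => (1 / 2 : ℝ) * ‖u' t‖ ^ 2 := by fun_prop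
  have hle := intervalIntegral.integral_mono_on (μ := volume) hpi (hcont.intervalIntegrable _ _)
    ((hi1.add hi2).intervalIntegrable _ _) (fun t _ => hpt t)
  simp only [Pi.add_apply] at hle
  rw [intervalIntegral.integral_add (hi1.intervalIntegrable _ _) (hi2.intervalIntegrable _ _),
    intervalIntegral.integral_const_mul, intervalIntegral.integral_const_mul] at hle
  rw [hsplit]
  linarith

/-! ### Averaging over rotations about a coordinate axis -/

/-- The rotation by the angle `θ` about the `l`-th coordinate axis, as a linear map. -/
noncomputable def rotLin (l : Fin 3) (θ : ℝ) : Space3 →ₗ[ℝ] Space3 where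
  toFun x := WithLp.toLp 2 fun i =>
    if i = l + 1 then Real.cos θ * x (l + 1) - Real.sin θ * x (l + 2)
    else if i = l + 2 then Real.sin θ * x (l + 1) + Real.cos θ * x (l + 2) else x i
  map_add' x y := by
    ext i
    simp only [PiLp.add_apply]
    split_ifs <;> ring
  map_smul' c x := by
    ext i
    simp only [PiLp.smul_apply, smul_eq_mul, RingHom.id_apply]
    split_ifs <;> ring

theorem rotLin_apply (l : Fin 3) (θ : ℝ) (x : Space3) (i : Fin 3) :
    rotLin l θ x i = if i = l + 1 then Real.cos θ * x (l + 1) - Real.sin θ * x (l + 2)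
      else if i = l + 2 then Real.sin θ * x (l + 1) + Real.cos θ * x (l + 2) else x i := rfl

theorem sum_fin_three_shift {M : Type*} [AddCommMonoid M] (l : Fin 3) (f : Fin 3 → M) :
    ∑ i, f i = f l + f (l + 1) + f (l + 2) := by
  fin_cases l
  · exact Fin.sum_univ_three f
  · rw [Fin.sum_univ_three, add_assoc, add_comm]; rfl
  · rw [Fin.sum_univ_three, add_comm, ← add_assoc]; rfl

theorem fin_three_ne (l : Fin 3) :
    l ≠ l + 1 ∧ l ≠ l + 2 ∧ l + 2 ≠ l + 1 := by
  fin_cases l <;> decide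

theorem norm_rotLin (l : Fin 3) (θ : ℝ) (x : Space3) : ‖rotLin l θ x‖ = ‖x‖ := by
  obtain ⟨h1, h2, h3⟩ := fin_three_ne l
  have h : ‖rotLin l θ x‖ ^ 2 = ‖x‖ ^ 2 := by
    rw [EuclideanSpace.real_norm_sq_eq, EuclideanSpace.real_norm_sq_eq,
      sum_fin_three_shift l, sum_fin_three_shift l]
    simp only [rotLin_apply, h1, h2, h3, if_true, if_false]
    linear_combination (x (l + 1) ^ 2 + x (l + 2) ^ 2) * Real.cos_sq_add_sin_sq θ
  exact (sq_eq_sq₀ (norm_nonneg _) (norm_nonneg _)).1 h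

theorem measurePreserving_rotLin (l : Fin 3) (θ : ℝ) :
    MeasurePreserving (rotLin l θ) volume volume :=
  ((⟨rotLin l θ, norm_rotLin l θ⟩ : Space3 →ₗᵢ[ℝ] Space3).toLinearIsometryEquiv
    rfl).measurePreserving

theorem continuous_rotLin (l : Fin 3) : Continuous fun p : ℝ × Space3 => rotLin l p.1 p.2 := by
  refine (PiLp.continuous_toLp 2 _).comp (continuous_pi fun i => ?_)
  have hc : ∀ j, Continuous fun p : ℝ × Space3 => p.2 j :=
    fun j => (EuclideanSpace.proj j : Space3 →L[ℝ] ℝ).continuous.comp continuous_snd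
  have h1 := Real.continuous_cos.comp (continuous_fst (X := ℝ) (Y := Space3))
  have h2 := Real.continuous_sin.comp (continuous_fst (X := ℝ) (Y := Space3))
  split_ifs
  · exact (h1.mul (hc _)).sub (h2.mul (hc _))
  · exact (h2.mul (hc _)).add (h1.mul (hc _))
  · exact hc i

theorem hasDerivAt_rotLin (l : Fin 3) (x : Space3) (θ : ℝ) :
    HasDerivAt (fun θ => rotLin l θ x)
      (rotLin l θ x (l + 1) • EuclideanSpace.single (l + 2) 1 -
        rotLin l θ x (l + 2) • EuclideanSpace.single (l + 1) 1) θ := by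
  obtain ⟨h1, h2, h3⟩ := fin_three_ne l
  rw [hasDerivAt_iff_hasFDerivAt, ← hasFDerivWithinAt_univ, hasFDerivWithinAt_euclidean]
  intro i
  rw [hasFDerivWithinAt_univ, hasFDerivAt_iff_hasDerivAt]
  have hc := Real.hasDerivAt_cos θ
  have hs := Real.hasDerivAt_sin θ
  simp only [ContinuousLinearMap.comp_apply, ContinuousLinearMap.toSpanSingleton_apply, one_smul,
    PiLp.proj_apply, rotLin_apply, PiLp.sub_apply, PiLp.smul_apply, PiLp.single_apply,
    smul_eq_mul, h3, if_true, if_false]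
  by_cases hi1 : i = l + 1
  · subst hi1
    simp only [h3.symm, if_true, if_false]
    refine ((hc.mul_const _).sub (hs.mul_const _)).congr_deriv ?_
    ring
  by_cases hi2 : i = l + 2
  · subst hi2
    simp only [h3, if_true, if_false]
    refine ((hs.mul_const _).add (hc.mul_const _)).congr_deriv ?_
    ring
  simp only [hi1, hi2, if_false]
  refine (hasDerivAt_const _ _).congr_deriv ?_
  ring

/-- Rotations preserve volume, so by Fubini averaging over the angle does not change the integral.
This stands in for cylindrical coordinates. -/
theorem integral_nonneg_of_rotLin (l : Fin 3) {F : Space3 → ℝ} (hF : Integrable F)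
    (h : ∀ x, 0 ≤ ∫ θ in (0)..(2 * Real.pi), F (rotLin l θ x)) : 0 ≤ ∫ x, F x := by
  have hpi : (0 : ℝ) < 2 * Real.pi := Real.two_pi_pos
  set μ : Measure ℝ := volume.restrict (Set.Ioc 0 (2 * Real.pi))
  have hmp : MeasurePreserving (fun p : ℝ × Space3 => (p.1, rotLin l p.1 p.2))
      (μ.prod volume) (μ.prod volume) :=
    (MeasurePreserving.id μ).skew_product (g := fun θ x => rotLin l θ x)
      (continuous_rotLin l).measurable
      (Filter.Eventually.of_forall fun θ => (measurePreserving_rotLin l θ).map_eq)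
  have hint : Integrable (fun p : ℝ × Space3 => F (rotLin l p.1 p.2)) (μ.prod volume) :=
    hmp.integrable_comp_of_integrable (hF.comp_snd μ)
  have e1 : ∫ p, F (rotLin l p.1 p.2) ∂(μ.prod volume) = (2 * Real.pi) * ∫ x, F x := by
    rw [integral_prod _ hint]
    have : ∀ θ, ∫ x, F (rotLin l θ x) = ∫ x, F x := fun θ =>
      (measurePreserving_rotLin l θ).integral_comp
        ((⟨rotLin l θ, norm_rotLin l θ⟩ : Space3 →ₗᵢ[ℝ] Space3).toLinearIsometryEquiv
          rfl).toHomeomorph.measurableEmbedding F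
    simp only [this, integral_const, smul_eq_mul]
    simp [μ, hpi.le]
  have e2 : 0 ≤ ∫ p, F (rotLin l p.1 p.2) ∂(μ.prod volume) := by
    rw [integral_prod_symm _ hint]
    refine integral_nonneg fun x => ?_
    have := h x
    rwa [intervalIntegral.integral_of_le hpi.le] at this
  rw [e1] at e2
  exact (mul_nonneg_iff_of_pos_left hpi).1 e2

theorem continuous_partialD {ψ : Space3 → Spinor} (hψ : ContDiff ℝ 1 ψ) (j : Fin 3) :
    Continuous (partialD j ψ) :=
  (hψ.continuous_fderiv one_ne_zero).clm_apply continuous_const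

theorem angularD_eq_fderiv (l : Fin 3) (ψ : Space3 → Spinor) (x : Space3) :
    angularD l ψ x = fderiv ℝ ψ x (x (l + 1) • EuclideanSpace.single (l + 2) 1 -
      x (l + 2) • EuclideanSpace.single (l + 1) 1) := by
  rw [map_sub, map_smul, map_smul]
  rfl

theorem continuous_angularD {ψ : Space3 → Spinor} (hψ : ContDiff ℝ 1 ψ) (l : Fin 3) :
    Continuous (angularD l ψ) := by
  have hc : ∀ j, Continuous fun x : Space3 => x j :=
    fun j => (EuclideanSpace.proj j : Space3 →L[ℝ] ℝ).continuous
  exact ((hc _).smul (continuous_partialD hψ _)).sub ((hc _).smul (continuous_partialD hψ _))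

/-- The weight is constant along a rotation orbit, and the derivative of `ψ` in the angle is
`angularD l ψ`, so the circle inequality applies. -/
theorem integral_rotLin_angular_nonneg {ψ : Space3 → Spinor} (hψ : ContDiff ℝ 1 ψ) (l : Fin 3)
    (x : Space3) :
    0 ≤ ∫ θ in (0)..(2 * Real.pi), ‖rotLin l θ x‖⁻¹ * (‖angularD l ψ (rotLin l θ x)‖ ^ 2 -
      spinForm l (ψ (rotLin l θ x)) (angularD l ψ (rotLin l θ x))) := by
  have hrot : Continuous fun θ => rotLin l θ x :=
    Continuous.comp (g := fun p : ℝ × Space3 => rotLin l p.1 p.2) (f := fun θ : ℝ => (θ, x))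
      (continuous_rotLin l) (Continuous.prodMk_left x)
  have hc : Continuous fun θ => angularD l ψ (rotLin l θ x) := (continuous_angularD hψ l).comp hrot
  have hd : ∀ θ, HasDerivAt (fun θ => ψ (rotLin l θ x)) (angularD l ψ (rotLin l θ x)) θ := by
    intro θ
    have h0 : HasFDerivAt ψ (fderiv ℝ ψ (rotLin l θ x)) (rotLin l θ x) :=
      (hψ.differentiable one_ne_zero _).hasFDerivAt
    rw [angularD_eq_fderiv]
    exact HasFDerivAt.comp_hasDerivAt (f := fun θ => rotLin l θ x) θ h0 (hasDerivAt_rotLin l x θ)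
  have hper : rotLin l (2 * Real.pi) x = rotLin l 0 x := by
    ext i
    simp [rotLin_apply]
  have key := integral_spinForm_deriv_le l hd hc (by simp only [hper])
  simp only [norm_rotLin]
  rw [intervalIntegral.integral_const_mul, intervalIntegral.integral_sub]
  · exact mul_nonneg (by positivity) (sub_nonneg.2 key)
  · exact (hc.norm.pow 2).intervalIntegrable _ _
  · exact (continuous_spinForm l (hψ.continuous.comp hrot) hc).intervalIntegrable _ _

/-! ### Integration by parts and the radial lower bound -/

/-- In polar coordinates `r² · r⁻¹ = r` is integrable near 0. -/
theorem integrable_norm_inv_mul {f : Space3 → ℝ} (hf : Continuous f) (hc : HasCompactSupport f) :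
    Integrable fun x => ‖x‖⁻¹ * f x := by
  obtain ⟨r, hr⟩ := hc.isCompact.isBounded.subset_ball (0 : Space3)
  obtain ⟨C, hC⟩ := hc.exists_bound_of_continuous hf
  have h1 : IntegrableOn (fun x : Space3 => ‖x‖⁻¹) (Metric.ball 0 r) := by
    rw [integrableOn_fun_norm_addHaar volume (f := fun y : ℝ => y⁻¹)]
    refine IntegrableOn.congr_fun (f := fun y : ℝ => y) ?_ (fun y hy => ?_) measurableSet_Ioo
    · exact continuous_id.integrableOn_Icc.mono_set Set.Ioo_subset_Icc_self
    · have : y ≠ 0 := hy.1.ne'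
      simp only [finrank_euclideanSpace, Fintype.card_fin, smul_eq_mul]
      field_simp
  have h2 : IntegrableOn (fun x => ‖x‖⁻¹ * f x) (Metric.ball 0 r) :=
    h1.mul_bdd hf.aestronglyMeasurable (Filter.Eventually.of_forall hC)
  refine (integrableOn_iff_integrable_of_support_subset fun x hx => hr ?_).1 h2
  exact subset_tsupport f (right_ne_zero_of_mul hx)

theorem lineDeriv_norm {x : Space3} (hx : x ≠ 0) (j : Fin 3) :
    lineDeriv ℝ (fun y : Space3 => ‖y‖) x (EuclideanSpace.single j 1) = ‖x‖⁻¹ * x j := by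
  have hl : HasDerivAt (fun t : ℝ => x + t • EuclideanSpace.single j (1 : ℝ))
      (EuclideanSpace.single j (1 : ℝ)) 0 := by
    simpa using ((hasDerivAt_id (0 : ℝ)).smul_const (EuclideanSpace.single j (1 : ℝ))).const_add x
  have h1 := (hl.norm_sq).sqrt (by simpa using hx)
  simp only [Real.sqrt_sq (norm_nonneg _), zero_smul, add_zero] at h1
  rw [lineDeriv, h1.deriv, EuclideanSpace.inner_single_right]
  have : ‖x‖ ≠ 0 := norm_ne_zero_iff.2 hx
  simp
  field_simp

/-- The weight `|x|` is not differentiable at the origin but is Lipschitz, which is enough for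
integration by parts. -/
theorem integral_norm_mul_fderiv {g : Space3 → ℝ} (hg : ContDiff ℝ 1 g) (hc : HasCompactSupport g)
    (j : Fin 3) :
    ∫ x, ‖x‖ * fderiv ℝ g x (EuclideanSpace.single j 1) = -∫ x, ‖x‖⁻¹ * (x j * g x) := by
  obtain ⟨D, hD⟩ := hg.lipschitzWith_of_hasCompactSupport hc one_ne_zero
  have h := LipschitzWith.integral_lineDeriv_mul_eq (μ := volume)
    (lipschitzWith_one_norm (E := Space3)) hD hc (EuclideanSpace.single j (1 : ℝ))
  have e1 : ∫ x, lineDeriv ℝ (fun y : Space3 => ‖y‖) x (EuclideanSpace.single j 1) * g x =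
      ∫ x, ‖x‖⁻¹ * (x j * g x) := by
    refine integral_congr_ae ?_
    have h0 : ∀ᵐ x : Space3, x ≠ 0 := by simp [ae_iff]
    filter_upwards [h0] with x hx
    rw [lineDeriv_norm hx, mul_assoc]
  have e2 : ∀ x, lineDeriv ℝ g x (-EuclideanSpace.single j 1) * ‖x‖ =
      -(‖x‖ * fderiv ℝ g x (EuclideanSpace.single j 1)) := by
    intro x
    rw [((hg.differentiable one_ne_zero) x).lineDeriv_eq_fderiv, map_neg]
    ring
  simp only [e2, integral_neg] at h
  rw [← e1]
  linarith [h]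

theorem IsTestSpinor.hasCompactSupport_of_eq_zero {β : Type*} [Zero β] {ψ : Space3 → Spinor}
    (hψ : IsTestSpinor ψ) {F : Space3 → β} (h : ∀ x, ψ x = 0 → F x = 0) : HasCompactSupport F :=
  hψ.2.mono fun x hx hx' => hx (h x hx')

theorem IsTestSpinor.hasCompactSupport_of_fderiv_eq_zero {β : Type*} [Zero β]
    {ψ : Space3 → Spinor} (hψ : IsTestSpinor ψ) {F : Space3 → β}
    (h : ∀ x, fderiv ℝ ψ x = 0 → F x = 0) : HasCompactSupport F :=
  (hψ.2.fderiv (𝕜 := ℝ)).mono fun x hx hx' => hx (h x hx')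

theorem IsTestSpinor.contDiff_partialD {ψ : Space3 → Spinor} (hψ : IsTestSpinor ψ)
    (j : Fin 3) : ContDiff ℝ 1 (partialD j ψ) :=
  (hψ.1.fderiv_right (m := 1) (by norm_cast)).clm_apply contDiff_const

theorem IsTestSpinor.contDiff_one {ψ : Space3 → Spinor} (hψ : IsTestSpinor ψ) : ContDiff ℝ 1 ψ :=
  hψ.1.of_le (by norm_cast)

theorem IsTestSpinor.fderiv_partialD_comm {ψ : Space3 → Spinor} (hψ : IsTestSpinor ψ)
    (j k : Fin 3) (x : Space3) :
    fderiv ℝ (partialD k ψ) x (EuclideanSpace.single j 1) =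
      fderiv ℝ (partialD j ψ) x (EuclideanSpace.single k 1) := by
  have hd : DifferentiableAt ℝ (fderiv ℝ ψ) x :=
    (hψ.1.fderiv_right (m := 1) (by norm_cast)).differentiable one_ne_zero x
  have key : ∀ v w : Space3, fderiv ℝ (fun y => fderiv ℝ ψ y v) x w =
      fderiv ℝ (fderiv ℝ ψ) x w v := by
    intro v w
    have := hd.hasFDerivAt.clm_apply (hasFDerivAt_const v x)
    rw [this.fderiv]
    simp
  have hs : IsSymmSndFDerivAt ℝ ψ x := hψ.1.contDiffAt.isSymmSndFDerivAt
    (by rw [minSmoothness_of_isRCLikeNormedField]; norm_cast)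
  change fderiv ℝ (fun y => fderiv ℝ ψ y _) x _ = fderiv ℝ (fun y => fderiv ℝ ψ y _) x _
  rw [key, key]
  exact hs _ _

/-- The form `2 B(∂ⱼψ, ∂ₖψ)` equals the divergence `∂ⱼ B(ψ, ∂ₖψ) - ∂ₖ B(ψ, ∂ⱼψ)`: second derivatives
cancel by symmetry, and antisymmetry of `B` gives the factor 2. Moving the derivatives onto `|x|`
produces `x/|x|`, which assembles `angularD`. -/
theorem IsTestSpinor.integral_norm_mul_spinForm {ψ : Space3 → Spinor} (hψ : IsTestSpinor ψ)
    (l : Fin 3) :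
    ∫ x, ‖x‖ * (2 * spinForm l (partialD (l + 1) ψ x) (partialD (l + 2) ψ x)) =
      -∫ x, ‖x‖⁻¹ * spinForm l (ψ x) (angularD l ψ x) := by
  set g : Fin 3 → Space3 → ℝ := fun k x => spinForm l (ψ x) (partialD k ψ x) with hgdef
  have hg : ∀ k, ContDiff ℝ 1 (g k) := fun k =>
    ((spinFormCLM l).contDiff.comp hψ.contDiff_one).clm_apply (hψ.contDiff_partialD k)
  have hgc : ∀ k, HasCompactSupport (g k) := fun k =>
    hψ.hasCompactSupport_of_eq_zero fun x hx => by simp [hgdef, hx, spinForm]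
  have hgd : ∀ k x v, fderiv ℝ (g k) x v =
      spinForm l (fderiv ℝ ψ x v) (partialD k ψ x) +
        spinForm l (ψ x) (fderiv ℝ (partialD k ψ) x v) := by
    intro k x v
    have h1 := (hψ.contDiff_one.differentiable one_ne_zero x).hasFDerivAt
    have h2 := ((hψ.contDiff_partialD k).differentiable one_ne_zero x).hasFDerivAt
    have h3 : HasFDerivAt (g k) _ x := ((spinFormCLM l).hasFDerivAt.comp x h1).clm_apply h2
    rw [h3.fderiv]
    simp [add_comm]
  have hc : ∀ j, Continuous fun x : Space3 => x j :=
    fun j => (EuclideanSpace.proj j : Space3 →L[ℝ] ℝ).continuous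
  have hint1 : ∀ j k, Integrable fun x =>
      ‖x‖ * fderiv ℝ (g k) x (EuclideanSpace.single j 1) := fun j k =>
    (continuous_norm.mul (((hg k).continuous_fderiv one_ne_zero).clm_apply
      continuous_const)).integrable_of_hasCompactSupport (((hgc k).fderiv_apply ℝ _).mul_left)
  have hint2 : ∀ j k, Integrable fun x : Space3 => ‖x‖⁻¹ * (x j * g k x) := fun j k =>
    integrable_norm_inv_mul ((hc j).mul (hg k).continuous) (hgc k).mul_left
  have e1 : ∀ x, ‖x‖ * (2 * spinForm l (partialD (l + 1) ψ x) (partialD (l + 2) ψ x)) =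
      ‖x‖ * fderiv ℝ (g (l + 2)) x (EuclideanSpace.single (l + 1) 1) -
        ‖x‖ * fderiv ℝ (g (l + 1)) x (EuclideanSpace.single (l + 2) 1) := by
    intro x
    rw [hgd, hgd, hψ.fderiv_partialD_comm (l + 2) (l + 1)]
    change _ = ‖x‖ * (spinForm l (partialD (l + 1) ψ x) (partialD (l + 2) ψ x) + _) -
      ‖x‖ * (spinForm l (partialD (l + 2) ψ x) (partialD (l + 1) ψ x) + _)
    rw [spinForm_antisymm l (partialD (l + 2) ψ x) (partialD (l + 1) ψ x)]
    ring
  have e2 : ∀ x, ‖x‖⁻¹ * spinForm l (ψ x) (angularD l ψ x) =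
      ‖x‖⁻¹ * (x (l + 1) * g (l + 2) x) - ‖x‖⁻¹ * (x (l + 2) * g (l + 1) x) := by
    intro x
    rw [angularD, spinForm_sub_right, spinForm_smul_right, spinForm_smul_right, mul_sub]
  simp only [e1, e2]
  rw [integral_sub (hint1 _ _) (hint1 _ _), integral_sub (hint2 _ _) (hint2 _ _),
    integral_norm_mul_fderiv (hg _) (hgc _), integral_norm_mul_fderiv (hg _) (hgc _)]
  ring

theorem IsTestSpinor.integrable_kineticDensity {ψ : Space3 → Spinor} (hψ : IsTestSpinor ψ) :
    Integrable (kineticDensity ψ) := by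
  have h : kineticDensity ψ = fun x => ‖x‖ * (∑ j, ‖partialD j ψ x‖ ^ 2 +
      2 * ∑ l : Fin 3, spinForm l (partialD (l + 1) ψ x) (partialD (l + 2) ψ x)) := by
    ext1 x
    rw [kineticDensity, norm_sq_diracOp]
  have hp := continuous_partialD hψ.contDiff_one
  rw [h]
  refine Continuous.integrable_of_hasCompactSupport ?_
    (hψ.hasCompactSupport_of_fderiv_eq_zero fun x hx => by simp [partialD, hx, spinForm])
  exact continuous_norm.mul ((continuous_finsetSum _ fun j _ => (hp j).norm.pow 2).add
    (continuous_const.mul (continuous_finsetSum _ fun l _ => continuous_spinForm l (hp _) (hp _))))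

theorem IsTestSpinor.integral_radial_le_kinetic {ψ : Space3 → Spinor} (hψ : IsTestSpinor ψ) :
    Integrable (fun x => ‖x‖⁻¹ * ‖fderiv ℝ ψ x x‖ ^ 2) ∧
    ∫ x, ‖x‖⁻¹ * ‖fderiv ℝ ψ x x‖ ^ 2 ≤ ∫ x, kineticDensity ψ x := by
  have hψ1 := hψ.contDiff_one
  have hrad : Integrable (fun x => ‖x‖⁻¹ * ‖fderiv ℝ ψ x x‖ ^ 2) := by
    refine integrable_norm_inv_mul
      (((hψ1.continuous_fderiv one_ne_zero).clm_apply continuous_id).norm.pow 2) ?_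
    exact hψ.hasCompactSupport_of_fderiv_eq_zero fun x hx => by simp [hx]
  refine ⟨hrad, ?_⟩
  have hang : ∀ l, Integrable fun x => ‖x‖⁻¹ * ‖angularD l ψ x‖ ^ 2 := fun l =>
    integrable_norm_inv_mul ((continuous_angularD hψ1 l).norm.pow 2)
      (hψ.hasCompactSupport_of_fderiv_eq_zero fun x hx => by simp [angularD_eq_fderiv, hx])
  have hspin : ∀ l, Integrable fun x => ‖x‖⁻¹ * spinForm l (ψ x) (angularD l ψ x) := fun l =>
    integrable_norm_inv_mul (continuous_spinForm l hψ1.continuous (continuous_angularD hψ1 l))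
      (hψ.hasCompactSupport_of_eq_zero fun x hx => by simp [hx, spinForm])
  have hcross : ∀ l : Fin 3, Integrable fun x =>
      ‖x‖ * (2 * spinForm l (partialD (l + 1) ψ x) (partialD (l + 2) ψ x)) := fun l => by
    refine Continuous.integrable_of_hasCompactSupport ?_ ?_
    · exact continuous_norm.mul (continuous_const.mul
        (continuous_spinForm l (continuous_partialD hψ1 _) (continuous_partialD hψ1 _)))
    · exact hψ.hasCompactSupport_of_fderiv_eq_zero fun x hx => by simp [partialD, hx, spinForm]
  have hnn : ∀ l, 0 ≤ ∫ x, ‖x‖⁻¹ * ‖angularD l ψ x‖ ^ 2 -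
      ‖x‖⁻¹ * spinForm l (ψ x) (angularD l ψ x) := fun l => by
    refine integral_nonneg_of_rotLin l ((hang l).sub (hspin l)) fun x => ?_
    simpa only [Pi.sub_apply, ← mul_sub] using integral_rotLin_angular_nonneg hψ1 l x
  have hpt : kineticDensity ψ = fun x => ‖x‖⁻¹ * ‖fderiv ℝ ψ x x‖ ^ 2 +
      ∑ l : Fin 3, (‖x‖⁻¹ * ‖angularD l ψ x‖ ^ 2 +
        ‖x‖ * (2 * spinForm l (partialD (l + 1) ψ x) (partialD (l + 2) ψ x))) := by
    ext1 x
    rw [kineticDensity, norm_sq_diracOp, mul_add, norm_mul_sum_norm_sq_partialD,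
      Finset.sum_add_distrib, ← Finset.mul_sum _ _ ‖x‖, ← Finset.mul_sum _ _ (2 : ℝ), add_assoc]
  have hsum : ∀ l : Fin 3, Integrable fun x => ‖x‖⁻¹ * ‖angularD l ψ x‖ ^ 2 +
      ‖x‖ * (2 * spinForm l (partialD (l + 1) ψ x) (partialD (l + 2) ψ x)) :=
    fun l => (hang l).add (hcross l)
  rw [hpt, integral_add hrad (integrable_finsetSum _ fun l _ => hsum l),
    integral_finsetSum _ fun l _ => hsum l]
  refine le_add_of_nonneg_right (Finset.sum_nonneg fun l _ => ?_)
  rw [integral_add (hang l) (hcross l), hψ.integral_norm_mul_spinForm l, ← sub_eq_add_neg,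
    ← integral_sub (hang l) (hspin l)]
  exact hnn l

/-! ### A logarithmic Hardy inequality on the half-line -/

section HalfLine

open Filter Set Topology

variable {E : Type*} [NormedAddCommGroup E] [InnerProductSpace ℝ E]

theorem hasDerivAt_log_div {R r : ℝ} (hR : 0 < R) (hr : 0 < r) :
    HasDerivAt (fun s => Real.log (s / R)) r⁻¹ r := by
  have h := ((hasDerivAt_id r).div_const R).log (div_ne_zero hr.ne' hR.ne')
  refine h.congr_deriv ?_
  have := hr.ne'
  simp only [id]
  field_simp

theorem log_div_ne_zero {R r : ℝ} (hR : 0 < R) (hr : 0 < r) (hne : r ≠ R) :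
    Real.log (r / R) ≠ 0 := by
  refine Real.log_ne_zero_of_pos_of_ne_one (div_pos hr hR) fun h => hne ?_
  rwa [div_eq_one_iff_eq hR.ne'] at h

/-- The boundary term `‖φ(r) - φ(R)‖² / (2 log(r/R))` in the logarithmic Hardy inequality. -/
noncomputable def hardyBoundary (R : ℝ) (φ : ℝ → E) (r : ℝ) : ℝ :=
  ‖φ r - φ R‖ ^ 2 / (2 * Real.log (r / R))

/-- Completing the square: the energy density `r|φ'|²` is the Hardy density plus a square plus an
exact derivative. -/
theorem hasDerivAt_hardyBoundary {R r : ℝ} (hR : 0 < R) (hr : 0 < r) (hne : r ≠ R)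
    {φ : ℝ → E} {φ' : E} (hφ : HasDerivAt φ φ' r) :
    HasDerivAt (hardyBoundary R φ) (r * ‖φ'‖ ^ 2 -
      (‖φ r - φ R‖ ^ 2 / (4 * r * Real.log (r / R) ^ 2) +
        r * ‖φ' - (1 / (2 * r * Real.log (r / R))) • (φ r - φ R)‖ ^ 2)) r := by
  have hl := log_div_ne_zero hR hr hne
  have h := ((hφ.sub_const (φ R)).norm_sq).div ((hasDerivAt_log_div hR hr).const_mul 2)
    (mul_ne_zero two_ne_zero hl)
  refine h.congr_deriv ?_
  rw [@norm_sub_sq_real _ _ _ φ', norm_smul, inner_smul_right, mul_pow ‖_‖, Real.norm_eq_abs,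
    sq_abs, real_inner_comm]
  have := hr.ne'
  field_simp
  ring

/-- Only `r = R` matters: there the numerator vanishes to second order and the logarithm to first,
so the limit is 0, which is also the value assigned at `R`. -/
theorem continuousAt_hardyBoundary {R r : ℝ} (hR : 0 < R) (hr : 0 < r)
    {φ : ℝ → E} (hφ : Differentiable ℝ φ) : ContinuousAt (hardyBoundary R φ) r := by
  rcases eq_or_ne r R with rfl | hne
  · rw [continuousAt_iff_punctured_nhds]
    have h1 := (hφ r).hasDerivAt.tendsto_slope
    have h2 := (hasDerivAt_log_div hR hr).tendsto_slope
    have h3 : Tendsto (fun s => s - r) (𝓝[≠] r) (𝓝 0) := by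
      have : Tendsto (fun s => s - r) (𝓝 r) (𝓝 (r - r)) := (continuous_sub_right r).tendsto r
      rw [sub_self] at this
      exact this.mono_left nhdsWithin_le_nhds
    have h4 := h3.mul ((h1.norm.pow 2).div (h2.const_mul 2)
      (mul_ne_zero two_ne_zero (inv_ne_zero hr.ne')))
    rw [zero_mul] at h4
    have h5 : hardyBoundary r φ r = 0 := by simp [hardyBoundary]
    rw [h5]
    refine h4.congr' ?_
    filter_upwards [self_mem_nhdsWithin] with s hs
    have hs' : s - r ≠ 0 := sub_ne_zero.2 hs
    simp only [Pi.div_apply, slope_def_module, norm_smul, mul_pow, hardyBoundary, div_self hr.ne', Real.log_one,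
      sub_zero, smul_eq_mul, norm_inv, Real.norm_eq_abs, inv_pow, sq_abs]
    -- Only `s ≠ r` is known here, so `s = 0` and `s = -r` are not excluded; there the logarithm is
    -- 0 and division by zero makes both sides 0.
    rcases eq_or_ne (Real.log (s / r)) 0 with h0 | h0
    · simp [h0]
    · field_simp
  · exact (hasDerivAt_hardyBoundary hR hr hne (hφ r).hasDerivAt).continuousAt

theorem continuousWithinAt_hardyBoundary_zero {E : Type*} [NormedAddCommGroup E] {R : ℝ}
    (hR : 0 < R) {φ : ℝ → E} (hφ : Continuous φ) : ContinuousWithinAt (hardyBoundary R φ) (Ici 0) 0 := by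
  rw [← continuousWithinAt_Ioi_iff_Ici]
  -- The convention `log 0 = 0` followed by division by zero gives the value 0, which agrees with
  -- the limit.
  have h0 : hardyBoundary R φ 0 = 0 := by simp [hardyBoundary]
  rw [ContinuousWithinAt, h0]
  have hnum : Tendsto (fun r => ‖φ r - φ R‖ ^ 2) (𝓝[>] 0) (𝓝 (‖φ 0 - φ R‖ ^ 2)) :=
    (((hφ.sub continuous_const).norm.pow 2).tendsto 0).mono_left nhdsWithin_le_nhds
  refine hnum.div_atBot (Tendsto.const_mul_atBot two_pos ?_)
  have hd : Tendsto (fun r => r / R) (𝓝[>] 0) (𝓝[>] 0) := by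
    refine tendsto_nhdsWithin_iff.2 ⟨?_, ?_⟩
    · have : Tendsto (fun r => r / R) (𝓝 0) (𝓝 (0 / R)) := (continuous_id.div_const R).tendsto 0
      rw [zero_div] at this
      exact this.mono_left nhdsWithin_le_nhds
    · filter_upwards [self_mem_nhdsWithin] with r hr using div_pos hr hR
  exact Real.tendsto_log_nhdsGT_zero.comp hd

theorem tendsto_hardyBoundary_atTop {E : Type*} [NormedAddCommGroup E] {R : ℝ} (hR : 0 < R)
    {φ : ℝ → E}
    (hc : HasCompactSupport φ) : Tendsto (hardyBoundary R φ) atTop (𝓝 0) := by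
  have h0 : Tendsto φ atTop (𝓝 0) :=
    hc.is_zero_at_infty.mono_left atTop_le_cocompact
  have hnum : Tendsto (fun r => ‖φ r - φ R‖ ^ 2) atTop (𝓝 (‖0 - φ R‖ ^ 2)) :=
    ((h0.sub_const _).norm.pow 2)
  exact hnum.div_atTop (Tendsto.const_mul_atTop two_pos
    (Real.tendsto_log_atTop.comp (tendsto_id.atTop_div_const hR)))

/-- The one-dimensional Hardy inequality on `(0, ∞)` in the variable `log r`, for functions
shifted to vanish at `r = R`. -/
theorem log_hardy_Ioi {R : ℝ} (hR : 0 < R) {φ : ℝ → E} (hφ : ContDiff ℝ 1 φ)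
    (hc : HasCompactSupport φ) :
    IntegrableOn (fun r => ‖φ r - φ R‖ ^ 2 / (4 * r * Real.log (r / R) ^ 2)) (Ioi 0) ∧
    ∫ r in Ioi 0, ‖φ r - φ R‖ ^ 2 / (4 * r * Real.log (r / R) ^ 2) ≤
      ∫ r in Ioi 0, r * ‖deriv φ r‖ ^ 2 := by
  have hd : Differentiable ℝ φ := hφ.differentiable one_ne_zero
  have hd' : Continuous (deriv φ) := hφ.continuous_deriv le_rfl
  have hec : Continuous fun r => r * ‖deriv φ r‖ ^ 2 := continuous_id.mul (hd'.norm.pow 2)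
  have hei : Integrable fun r => r * ‖deriv φ r‖ ^ 2 := by
    refine hec.integrable_of_hasCompactSupport (HasCompactSupport.mul_left ?_)
    exact hc.deriv.comp_left (g := fun p => ‖p‖ ^ 2) (by simp)
  set k : ℝ → ℝ := fun r => ‖φ r - φ R‖ ^ 2 / (4 * r * Real.log (r / R) ^ 2)
  set w : ℝ → ℝ := fun r => k r +
    r * ‖deriv φ r - (1 / (2 * r * Real.log (r / R))) • (φ r - φ R)‖ ^ 2
  -- `W` is a primitive of `w` off `r = R` and is continuous across it. It runs from 0 to the full
  -- energy, so `∫ w` is the energy; integrability of `w` comes from `w ≥ 0` on each side of `R`.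
  set W : ℝ → ℝ := fun r => (∫ s in (0)..r, s * ‖deriv φ s‖ ^ 2) - hardyBoundary R φ r with hW
  have hkw : ∀ r ∈ Ioi (0 : ℝ), k r ≤ w r := fun r hr =>
    le_add_of_nonneg_right (mul_nonneg (le_of_lt hr) (by positivity))
  have hk0 : ∀ r ∈ Ioi (0 : ℝ), 0 ≤ k r := fun r hr => by
    have : (0 : ℝ) < r := hr
    positivity
  have hP : ∀ r, HasDerivAt (fun r => ∫ s in (0)..r, s * ‖deriv φ s‖ ^ 2)
      (r * ‖deriv φ r‖ ^ 2) r := fun r =>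
    intervalIntegral.integral_hasDerivAt_right (hec.intervalIntegrable _ _)
      (hec.stronglyMeasurableAtFilter _ _) hec.continuousAt
  have hWd : ∀ r, 0 < r → r ≠ R → HasDerivAt W (w r) r := fun r hr hne => by
    refine ((hP r).sub (hasDerivAt_hardyBoundary hR hr hne (hd r).hasDerivAt)).congr_deriv ?_
    simp only [w, k]
    ring
  have hWc : ∀ r, 0 < r → ContinuousAt W r := fun r hr =>
    (hP r).continuousAt.sub (continuousAt_hardyBoundary hR hr hd)
  have hWR : W R = ∫ s in (0)..R, s * ‖deriv φ s‖ ^ 2 := by simp [hW, hardyBoundary]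
  have hW0 : W 0 = 0 := by simp [hW, hardyBoundary]
  have hWc0 : ContinuousOn W (Icc 0 R) := by
    intro r hr
    rcases hr.1.eq_or_lt with rfl | hr0
    · exact ((hP 0).continuousAt.continuousWithinAt.sub
        (continuousWithinAt_hardyBoundary_zero hR hd.continuous)).mono Icc_subset_Ici_self
    · exact (hWc r hr0).continuousWithinAt
  have hw0 : ∀ r ∈ Ioi (0 : ℝ), 0 ≤ w r := fun r hr => (hk0 r hr).trans (hkw r hr)
  have hi1 : IntegrableOn w (Ioc 0 R) :=
    intervalIntegral.integrableOn_deriv_of_nonneg hWc0 (fun r hr => hWd r hr.1 hr.2.ne)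
      (fun r hr => hw0 r hr.1)
  have hI1 : ∫ r in Ioc 0 R, w r = ∫ s in (0)..R, s * ‖deriv φ s‖ ^ 2 := by
    rw [← intervalIntegral.integral_of_le hR.le,
      intervalIntegral.integral_eq_sub_of_hasDerivAt_of_le hR.le hWc0
      (fun r hr => hWd r hr.1 hr.2.ne)
      ((intervalIntegrable_iff_integrableOn_Ioc_of_le hR.le).2 hi1), hW0, hWR, sub_zero]
  have hlim : Tendsto W atTop (𝓝 (∫ r in Ioi 0, r * ‖deriv φ r‖ ^ 2)) := by
    have := (intervalIntegral_tendsto_integral_Ioi 0 hei.integrableOn tendsto_id).sub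
      (tendsto_hardyBoundary_atTop hR hc)
    rwa [sub_zero] at this
  have hi2 : IntegrableOn w (Ioi R) :=
    integrableOn_Ioi_deriv_of_nonneg (hWc R hR).continuousWithinAt
      (fun r hr => hWd r (hR.trans hr) (ne_of_gt hr)) (fun r hr => hw0 r (hR.trans hr)) hlim
  have hI2 : ∫ r in Ioi R, w r = (∫ r in Ioi 0, r * ‖deriv φ r‖ ^ 2) - W R :=
    integral_Ioi_of_hasDerivAt_of_nonneg (hWc R hR).continuousWithinAt
      (fun r hr => hWd r (hR.trans hr) (ne_of_gt hr)) (fun r hr => hw0 r (hR.trans hr)) hlim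
  have hi : IntegrableOn w (Ioi 0) := by
    rw [← Ioc_union_Ioi_eq_Ioi hR.le]
    exact hi1.union hi2
  have hI : ∫ r in Ioi 0, w r = ∫ r in Ioi 0, r * ‖deriv φ r‖ ^ 2 := by
    rw [← Ioc_union_Ioi_eq_Ioi hR.le, setIntegral_union Ioc_disjoint_Ioi_same measurableSet_Ioi
      hi1 hi2, hI1, hI2, hWR, Ioc_union_Ioi_eq_Ioi hR.le]
    ring
  have hkm : Measurable k := by
    have h1 : Measurable fun r => ‖φ r - φ R‖ ^ 2 :=
      ((hd.continuous.sub continuous_const).norm.pow 2).measurable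
    exact h1.div ((measurable_const.mul measurable_id).mul
      ((Real.measurable_log.comp (measurable_id.div_const R)).pow_const 2))
  have hki : IntegrableOn k (Ioi 0) := by
    refine hi.mono' hkm.aestronglyMeasurable ?_
    filter_upwards [ae_restrict_mem measurableSet_Ioi] with r hr
    rw [Real.norm_of_nonneg (hk0 r hr)]
    exact hkw r hr
  exact ⟨hki, hI ▸ setIntegral_mono_on hki hi measurableSet_Ioi hkw⟩

/-- The integrated form of `r³‖χ'‖² = r‖(rχ)'‖² + r‖χ‖² - (r²‖χ‖²)'`. -/
theorem integral_Ioi_cube_mul_norm_deriv_sq {χ : ℝ → E} (hχ : ContDiff ℝ 1 χ)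
    (hc : HasCompactSupport χ) :
    ∫ r in Ioi 0, r ^ 3 * ‖deriv χ r‖ ^ 2 =
      (∫ r in Ioi 0, r * ‖deriv (fun s => s • χ s) r‖ ^ 2) + ∫ r in Ioi 0, r * ‖χ r‖ ^ 2 := by
  have hd : Differentiable ℝ χ := hχ.differentiable one_ne_zero
  have hφ : ContDiff ℝ 1 fun s : ℝ => s • χ s := contDiff_id.smul hχ
  have hf : ContDiff ℝ 1 fun s : ℝ => s ^ 2 * ‖χ s‖ ^ 2 := (contDiff_id.pow 2).mul (hχ.norm_sq ℝ)
  have hχ2 : HasCompactSupport fun s => ‖χ s‖ ^ 2 :=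
    hc.comp_left (g := fun p => ‖p‖ ^ 2) (by simp)
  have hfc : HasCompactSupport fun s : ℝ => s ^ 2 * ‖χ s‖ ^ 2 := hχ2.mul_left
  have h0 := hfc.integral_Ioi_deriv_eq hf 0
  have hi0 : Integrable (deriv fun s : ℝ => s ^ 2 * ‖χ s‖ ^ 2) :=
    (hf.continuous_deriv le_rfl).integrable_of_hasCompactSupport hfc.deriv
  have hi1 : Integrable fun r => r * ‖deriv (fun s => s • χ s) r‖ ^ 2 := by
    have hφc : HasCompactSupport fun s : ℝ => s • χ s :=
      hc.mono fun s hs hs' => hs (by simp only [hs', smul_zero])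
    have hcont : Continuous fun r => r * ‖deriv (fun s => s • χ s) r‖ ^ 2 :=
      continuous_id.mul ((hφ.continuous_deriv le_rfl).norm.pow 2)
    exact hcont.integrable_of_hasCompactSupport
      (hφc.deriv.mono fun s hs hs' => hs (by simp [hs']))
  have hi2 : Integrable fun r => r * ‖χ r‖ ^ 2 :=
    (continuous_id.mul (hχ.continuous.norm.pow 2)).integrable_of_hasCompactSupport hχ2.mul_left
  have hpt : ∀ r, r ^ 3 * ‖deriv χ r‖ ^ 2 = r * ‖deriv (fun s => s • χ s) r‖ ^ 2 + r * ‖χ r‖ ^ 2 -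
      deriv (fun s : ℝ => s ^ 2 * ‖χ s‖ ^ 2) r := by
    intro r
    have e1 : HasDerivAt (fun s => s • χ s) (r • deriv χ r + (1 : ℝ) • χ r) r :=
      HasDerivAt.fun_smul (hasDerivAt_id r) (hd r).hasDerivAt
    have e2 := ((hasDerivAt_id r).pow 2).mul (hd r).hasDerivAt.norm_sq
    have e3 : HasDerivAt (fun s : ℝ => s ^ 2 * ‖χ s‖ ^ 2) _ r := e2
    rw [e1.deriv, e3.deriv, @norm_add_sq_real, one_smul, norm_smul, mul_pow, Real.norm_eq_abs,
      sq_abs, inner_smul_left, real_inner_comm]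
    simp
    ring
  have hi3 : Integrable fun r => r * ‖deriv (fun s => s • χ s) r‖ ^ 2 + r * ‖χ r‖ ^ 2 :=
    hi1.add hi2
  simp only [hpt]
  rw [integral_sub hi3.integrableOn hi0.integrableOn, h0,
    integral_add hi1.integrableOn hi2.integrableOn]
  simp

end HalfLine

/-! ### Polar coordinates and the inequality -/

/-- The `ENNReal` form needs no integrability, so finiteness of the right-hand integrals can be
deduced from the inequality itself. -/
theorem lintegral_eq_lintegral_toSphere {f : Space3 → ENNReal} (hf : Measurable f) :
    ∫⁻ x, f x = ∫⁻ ξ : Metric.sphere (0 : Space3) 1, ∫⁻ r in Set.Ioi (0 : ℝ),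
      ENNReal.ofReal (r ^ 2) * f (r • (ξ : Space3)) ∂volume ∂(volume : Measure Space3).toSphere := by
  have hmp := (volume : Measure Space3).measurePreserving_homeomorphUnitSphereProd
  have hg : Measurable fun p : Metric.sphere (0 : Space3) 1 × Set.Ioi (0 : ℝ) =>
      f ((p.2 : ℝ) • (p.1 : Space3)) := by
    refine hf.comp (Continuous.measurable ?_)
    fun_prop
  have h1 : ∫⁻ x, f x = ∫⁻ x : ({0}ᶜ : Set Space3), f x ∂(volume.comap Subtype.val) := by
    rw [lintegral_subtype_comap (measurableSet_singleton _).compl, restrict_compl_singleton]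
  have h2 : ∫⁻ x : ({0}ᶜ : Set Space3), f x ∂(volume.comap Subtype.val) =
      ∫⁻ p, f ((p.2 : ℝ) • (p.1 : Space3)) ∂((volume : Measure Space3).toSphere.prod
        (Measure.volumeIoiPow (Module.finrank ℝ Space3 - 1))) := by
    rw [← hmp.lintegral_comp hg]
    refine lintegral_congr fun x => ?_
    have hx : ‖(x : Space3)‖ ≠ 0 := norm_ne_zero_iff.2 x.2
    simp [smul_smul, mul_inv_cancel₀ hx]
  rw [h1, h2, lintegral_prod _ hg.aemeasurable]
  refine lintegral_congr fun ξ => ?_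
  have hgξ : Measurable fun r : ℝ => f (r • (ξ : Space3)) :=
    hf.comp (continuous_id.smul continuous_const).measurable
  have hw := lintegral_withDensity_eq_lintegral_mul
    ((volume : Measure ℝ).comap (Subtype.val : Set.Ioi (0 : ℝ) → ℝ))
    (f := fun r => ENNReal.ofReal ((r : ℝ) ^ 2)) (by fun_prop) (hgξ.comp measurable_subtype_coe)
  rw [Measure.volumeIoiPow, finrank_euclideanSpace_fin]
  refine hw.trans ?_
  exact lintegral_subtype_comap measurableSet_Ioi
    (fun r : ℝ => ENNReal.ofReal (r ^ 2) * f (r • (ξ : Space3)))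

theorem IsTestSpinor.measurable_coulombDensity {ψ : Space3 → Spinor} (hψ : IsTestSpinor ψ) :
    Measurable (coulombDensity ψ) :=
  (hψ.1.continuous.norm.pow 2).measurable.div measurable_norm

theorem IsTestSpinor.measurable_logDensity {ψ : Space3 → Spinor} (hψ : IsTestSpinor ψ) (R : ℝ) :
    Measurable (logDensity R ψ) := by
  have hm : Measurable ψ := hψ.1.continuous.measurable
  have h1 : Measurable fun x : Space3 => R / ‖x‖ := measurable_const.div measurable_norm
  have h2 : Measurable fun x => ψ x - (R / ‖x‖) • ψ ((R / ‖x‖) • x) :=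
    hm.sub (h1.smul (hm.comp (h1.smul measurable_id)))
  exact (h2.norm.pow_const 2).div (measurable_norm.mul
    ((Real.measurable_log.comp (measurable_norm.div_const R)).pow_const 2))

theorem coulombDensity_nonneg (ψ : Space3 → Spinor) (x : Space3) : 0 ≤ coulombDensity ψ x := by
  unfold coulombDensity
  positivity

theorem logDensity_nonneg (R : ℝ) (ψ : Space3 → Spinor) (x : Space3) : 0 ≤ logDensity R ψ x := by
  unfold logDensity
  positivity

/-- On the ray, with `φ = rχ`, the difference in `logDensity` is `(φ(r) - φ(R))/r`. The two
half-line lemmas then give the two terms on the left. -/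
theorem IsTestSpinor.lintegral_ray_le {ψ : Space3 → Spinor} (hψ : IsTestSpinor ψ) {R : ℝ}
    (hR : 0 < R) {ξ : Space3} (hξ : ‖ξ‖ = 1) :
    ∫⁻ r in Set.Ioi (0 : ℝ), ENNReal.ofReal (r ^ 2) *
        ENNReal.ofReal (coulombDensity ψ (r • ξ) + 1 / 4 * logDensity R ψ (r • ξ)) ≤
      ∫⁻ r in Set.Ioi (0 : ℝ), ENNReal.ofReal (r ^ 2) *
        ENNReal.ofReal (‖r • ξ‖⁻¹ * ‖fderiv ℝ ψ (r • ξ) (r • ξ)‖ ^ 2) := by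
  have hξ0 : ξ ≠ 0 := norm_ne_zero_iff.1 (by rw [hξ]; exact one_ne_zero)
  set χ : ℝ → Spinor := fun r => ψ (r • ξ)
  have hχ : ContDiff ℝ 1 χ := hψ.contDiff_one.comp (contDiff_id.smul contDiff_const)
  have hχc : HasCompactSupport χ := hψ.2.comp_isClosedEmbedding (isClosedEmbedding_smul_left hξ0)
  have hχd : ∀ r, deriv χ r = fderiv ℝ ψ (r • ξ) ξ := by
    intro r
    have h1 : HasDerivAt (fun s : ℝ => s • ξ) ξ r := by
      simpa using (hasDerivAt_id r).smul_const ξ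
    have h2 : HasFDerivAt ψ (fderiv ℝ ψ (r • ξ)) (r • ξ) :=
      (hψ.contDiff_one.differentiable one_ne_zero _).hasFDerivAt
    exact (HasFDerivAt.comp_hasDerivAt (f := fun s : ℝ => s • ξ) r h2 h1).deriv
  have hφ : ContDiff ℝ 1 fun s : ℝ => s • χ s := contDiff_id.smul hχ
  have hφc : HasCompactSupport fun s : ℝ => s • χ s :=
    hχc.mono fun s hs hs' => hs (by simp only [hs', smul_zero])
  obtain ⟨hk, hle⟩ := log_hardy_Ioi hR hφ hφc
  have heq := integral_Ioi_cube_mul_norm_deriv_sq hχ hχc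
  set k : ℝ → ℝ := fun r => ‖r • χ r - R • χ R‖ ^ 2 / (4 * r * Real.log (r / R) ^ 2)
  have hA : IntegrableOn (fun r => r * ‖χ r‖ ^ 2) (Set.Ioi 0) := by
    have hcont : Continuous fun r => r * ‖χ r‖ ^ 2 := continuous_id.mul (hχ.continuous.norm.pow 2)
    exact (hcont.integrable_of_hasCompactSupport
      (hχc.mono fun s hs hs' => hs (by simp [hs']))).integrableOn
  have hB : IntegrableOn (fun r => r ^ 3 * ‖deriv χ r‖ ^ 2) (Set.Ioi 0) := by
    have hcont : Continuous fun r => r ^ 3 * ‖deriv χ r‖ ^ 2 :=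
      (continuous_id.pow 3).mul ((hχ.continuous_deriv le_rfl).norm.pow 2)
    exact (hcont.integrable_of_hasCompactSupport
      (hχc.deriv.mono fun s hs hs' => hs (by simp [hs']))).integrableOn
  have hAk : IntegrableOn (fun r => r * ‖χ r‖ ^ 2 + k r) (Set.Ioi 0) := hA.add hk
  have hint : ∫ r in Set.Ioi 0, (r * ‖χ r‖ ^ 2 + k r) ≤
      ∫ r in Set.Ioi 0, r ^ 3 * ‖deriv χ r‖ ^ 2 := by
    rw [integral_add hA hk, heq]
    linarith
  have hl : ∫⁻ r in Set.Ioi (0 : ℝ), ENNReal.ofReal (r ^ 2) *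
        ENNReal.ofReal (coulombDensity ψ (r • ξ) + 1 / 4 * logDensity R ψ (r • ξ)) =
      ∫⁻ r in Set.Ioi (0 : ℝ), ENNReal.ofReal (r * ‖χ r‖ ^ 2 + k r) := by
    refine setLIntegral_congr_fun measurableSet_Ioi fun r hr => ?_
    have hr0 : 0 < r := hr
    rw [← ENNReal.ofReal_mul (by positivity)]
    have hn : ‖r • ξ‖ = r := by rw [norm_smul, hξ, mul_one, Real.norm_of_nonneg hr0.le]
    have e1 : (R / r) • r • ξ = R • ξ := by rw [smul_smul, div_mul_cancel₀ _ hr0.ne']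
    have e2 : ‖r • χ r - R • χ R‖ ^ 2 = r ^ 2 * ‖χ r - (R / r) • χ R‖ ^ 2 := by
      rw [← Real.norm_of_nonneg hr0.le, ← mul_pow, ← norm_smul, Real.norm_of_nonneg hr0.le,
        smul_sub, smul_smul, mul_div_cancel₀ _ hr0.ne']
    have e3 : ψ (r • ξ) = χ r := rfl
    have e4 : ψ (R • ξ) = χ R := rfl
    simp only [coulombDensity, logDensity, hn, e1, e3, e4, k, e2]
    congr 1
    rcases eq_or_ne (Real.log (r / R)) 0 with h0 | h0
    · rw [h0]
      field_simp
    · field_simp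
  have hr : ∫⁻ r in Set.Ioi (0 : ℝ), ENNReal.ofReal (r ^ 2) *
        ENNReal.ofReal (‖r • ξ‖⁻¹ * ‖fderiv ℝ ψ (r • ξ) (r • ξ)‖ ^ 2) =
      ∫⁻ r in Set.Ioi (0 : ℝ), ENNReal.ofReal (r ^ 3 * ‖deriv χ r‖ ^ 2) := by
    refine setLIntegral_congr_fun measurableSet_Ioi fun r hr => ?_
    have hr0 : 0 < r := hr
    rw [← ENNReal.ofReal_mul (by positivity), map_smul, hχd, norm_smul, norm_smul, hξ,
      Real.norm_of_nonneg hr0.le]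
    congr 1
    field_simp
  rw [hl, hr, ← ofReal_integral_eq_lintegral_ofReal hAk, ← ofReal_integral_eq_lintegral_ofReal hB]
  · exact ENNReal.ofReal_le_ofReal hint
  · filter_upwards [ae_restrict_mem measurableSet_Ioi] with r hr
    have hr0 : 0 < r := hr
    simp only [Pi.zero_apply]
    positivity
  · filter_upwards [ae_restrict_mem measurableSet_Ioi] with r hr
    have hr0 : 0 < r := hr
    simp only [Pi.zero_apply, k]
    positivity

theorem IsTestSpinor.dirac_hardy {ψ : Space3 → Spinor} (hψ : IsTestSpinor ψ) {R : ℝ}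
    (hR : 0 < R) :
    Integrable (kineticDensity ψ) ∧ Integrable (coulombDensity ψ) ∧ Integrable (logDensity R ψ) ∧
      (∫ x, coulombDensity ψ x) + (1 / 4 : ℝ) * ∫ x, logDensity R ψ x ≤
        ∫ x, kineticDensity ψ x := by
  obtain ⟨hrad, hradle⟩ := hψ.integral_radial_le_kinetic
  have hmc := hψ.measurable_coulombDensity
  have hml := hψ.measurable_logDensity R
  set S : Space3 → ℝ := fun x => coulombDensity ψ x + 1 / 4 * logDensity R ψ x with hS
  have hmS : Measurable S := hmc.add (hml.const_mul _)
  have hS0 : ∀ x, 0 ≤ S x := fun x =>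
    add_nonneg (coulombDensity_nonneg ψ x) (mul_nonneg (by norm_num) (logDensity_nonneg R ψ x))
  have hmrad : Measurable fun x => ‖x‖⁻¹ * ‖fderiv ℝ ψ x x‖ ^ 2 :=
    measurable_norm.inv.mul (((hψ.contDiff_one.continuous_fderiv one_ne_zero).clm_apply
      continuous_id).norm.pow 2).measurable
  have hle : ∫⁻ x, ENNReal.ofReal (S x) ≤
      ∫⁻ x, ENNReal.ofReal (‖x‖⁻¹ * ‖fderiv ℝ ψ x x‖ ^ 2) := by
    rw [lintegral_eq_lintegral_toSphere hmS.ennreal_ofReal,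
      lintegral_eq_lintegral_toSphere hmrad.ennreal_ofReal]
    exact lintegral_mono fun ξ => hψ.lintegral_ray_le hR (by simp)
  have hrad0 : ∀ x : Space3, 0 ≤ ‖x‖⁻¹ * ‖fderiv ℝ ψ x x‖ ^ 2 := fun x => by positivity
  rw [← ofReal_integral_eq_lintegral_ofReal hrad (Filter.Eventually.of_forall hrad0)] at hle
  -- `S` is nonnegative with finite integral, and it dominates each of its nonnegative summands.
  have hiS : Integrable S :=
    (lintegral_ofReal_ne_top_iff_integrable hmS.aestronglyMeasurable
      (Filter.Eventually.of_forall hS0)).1 (ne_top_of_le_ne_top ENNReal.ofReal_ne_top hle)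
  rw [← ofReal_integral_eq_lintegral_ofReal hiS (Filter.Eventually.of_forall hS0),
    ENNReal.ofReal_le_ofReal_iff (integral_nonneg hrad0)] at hle
  have hic : Integrable (coulombDensity ψ) := by
    refine hiS.mono' hmc.aestronglyMeasurable (Filter.Eventually.of_forall fun x => ?_)
    rw [Real.norm_of_nonneg (coulombDensity_nonneg ψ x)]
    have := logDensity_nonneg R ψ x
    simp only [hS]
    linarith
  have hil : Integrable (logDensity R ψ) := by
    refine (hiS.const_mul 4).mono' hml.aestronglyMeasurable (Filter.Eventually.of_forall fun x => ?_)
    rw [Real.norm_of_nonneg (logDensity_nonneg R ψ x)]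
    have := coulombDensity_nonneg ψ x
    simp only [hS]
    linarith
  refine ⟨hψ.integrable_kineticDensity, hic, hil, ?_⟩
  rw [← integral_const_mul, ← integral_add hic (hil.const_mul _)]
  exact hle.trans hradle

/-! ### Radial test spinors -/

theorem integral_Ioi_comp_log {R : ℝ} (hR : 0 < R) (H : ℝ → ℝ) :
    ∫ y in Set.Ioi (0 : ℝ), H (Real.log (y / R)) / y = ∫ t, H t := by
  have himg : (fun t => R * Real.exp t) '' Set.univ = Set.Ioi 0 := by
    ext y
    simp only [Set.image_univ, Set.mem_range, Set.mem_Ioi]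
    constructor
    · rintro ⟨t, rfl⟩
      positivity
    · intro hy
      exact ⟨Real.log (y / R), by rw [Real.exp_log (div_pos hy hR), mul_div_cancel₀ _ hR.ne']⟩
  have h := integral_image_eq_integral_abs_deriv_smul (s := Set.univ)
    (f := fun t => R * Real.exp t) (f' := fun t => R * Real.exp t) MeasurableSet.univ
    (fun t _ => ((Real.hasDerivAt_exp t).const_mul R).hasDerivWithinAt)
    (fun s _ t _ hst => Real.exp_injective (mul_left_cancel₀ hR.ne' hst))
    (fun y => H (Real.log (y / R)) / y)
  rw [himg, setIntegral_univ] at h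
  rw [h]
  refine integral_congr_ae (Filter.Eventually.of_forall fun t => ?_)
  have hpos : 0 < R * Real.exp t := by positivity
  simp only [abs_of_pos hpos, smul_eq_mul]
  rw [mul_div_cancel_left₀ _ hR.ne', Real.log_exp, mul_div_cancel₀ _ hpos.ne']

/-- The surface measure of the unit sphere in `ℝ³`, as `3` times the volume of the unit ball. -/
noncomputable def sphereArea : ℝ := 3 * (volume : Measure Space3).real (Metric.ball 0 1)

theorem sphereArea_pos : 0 < sphereArea := by
  have : 0 < (volume : Measure Space3).real (Metric.ball 0 1) :=
    ENNReal.toReal_pos (Metric.measure_ball_pos _ _ one_pos).ne' measure_ball_lt_top.ne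
  unfold sphereArea
  positivity

/-- With `t = log(r/R)`, the measure `r⁻³ · r² dr` is `dt`. -/
theorem integral_comp_log_norm {R : ℝ} (hR : 0 < R) (H : ℝ → ℝ) :
    ∫ x : Space3, H (Real.log (‖x‖ / R)) / ‖x‖ ^ 3 = sphereArea * ∫ t, H t := by
  rw [integral_fun_norm_addHaar volume (fun y : ℝ => H (Real.log (y / R)) / y ^ 3),
    finrank_euclideanSpace_fin, ← integral_Ioi_comp_log hR H, sphereArea, nsmul_eq_mul,
    smul_eq_mul, ← mul_assoc]
  congr 1
  refine setIntegral_congr_fun measurableSet_Ioi fun y hy => ?_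
  have hy0 : y ≠ 0 := ne_of_gt hy
  simp only [smul_eq_mul]
  field_simp

/-- The radial spinor `φ(log(|x|/R)) / |x|` times the first basis vector of `ℂ⁴`. -/
noncomputable def radialSpinor (R : ℝ) (φ : ℝ → ℝ) (x : Space3) : Spinor :=
  (φ (Real.log (‖x‖ / R)) / ‖x‖) • EuclideanSpace.single 0 (1 : ℂ)

section Radial

variable {R : ℝ} {φ : ℝ → ℝ}

theorem hasCompactSupport_sq (hc : HasCompactSupport φ) : HasCompactSupport fun t => φ t ^ 2 :=
  hc.mono fun t ht ht' => ht (by simp [ht'])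

theorem exists_eq_zero_of_lt_abs (hc : HasCompactSupport φ) :
    ∃ M, ∀ t, M < |t| → φ t = 0 := by
  obtain ⟨M, hM⟩ := hc.isCompact.isBounded.subset_closedBall (0 : ℝ)
  refine ⟨M, fun t ht => ?_⟩
  by_contra h
  have := hM (subset_tsupport φ h)
  rw [mem_closedBall_zero_iff, Real.norm_eq_abs] at this
  linarith

/-- Compact support of `φ` in the logarithmic variable confines the spinor to an annulus, away from
the singularity at 0. -/
theorem isTestSpinor_radialSpinor (hR : 0 < R) (hφ : ContDiff ℝ ∞ φ) (hc : HasCompactSupport φ) :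
    IsTestSpinor (radialSpinor R φ) := by
  obtain ⟨M, hM⟩ := exists_eq_zero_of_lt_abs hc
  constructor
  · rw [contDiff_iff_contDiffAt]
    intro x
    rcases eq_or_ne x 0 with rfl | hx
    · have hev : radialSpinor R φ =ᶠ[nhds 0] fun _ => 0 := by
        have hpos : 0 < R * Real.exp (-M) := by positivity
        filter_upwards [Metric.ball_mem_nhds (0 : Space3) hpos] with y hy
        rw [mem_ball_zero_iff] at hy
        rcases eq_or_ne y 0 with rfl | hy0
        · simp [radialSpinor]
        have hyp : 0 < ‖y‖ := norm_pos_iff.2 hy0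
        have hlog : Real.log (‖y‖ / R) < -M := by
          rw [Real.log_lt_iff_lt_exp (div_pos hyp hR), div_lt_iff₀ hR, mul_comm]
          exact hy
        rw [radialSpinor, hM _ ((by linarith : M < -Real.log (‖y‖ / R)).trans_le
          (neg_le_abs _)), zero_div, zero_smul]
      exact contDiffAt_const.congr_of_eventuallyEq hev
    · have hn : ContDiffAt ℝ ∞ (fun y : Space3 => ‖y‖) x := contDiffAt_norm ℝ hx
      have hxp : 0 < ‖x‖ := norm_pos_iff.2 hx
      have hl : ContDiffAt ℝ ∞ (fun y : Space3 => Real.log (‖y‖ / R)) x :=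
        (hn.div_const R).log (div_pos hxp hR).ne'
      exact ((hφ.contDiffAt.comp x hl).div hn hxp.ne').smul contDiffAt_const
  · refine HasCompactSupport.of_support_subset_isCompact
      (isCompact_closedBall (0 : Space3) (R * Real.exp M)) fun x hx => ?_
    rw [mem_closedBall_zero_iff]
    by_contra! h
    refine hx ?_
    have hxp : 0 < ‖x‖ := lt_trans (by positivity) h
    have hlog : M < Real.log (‖x‖ / R) := by
      rw [Real.lt_log_iff_exp_lt (div_pos hxp hR), lt_div_iff₀ hR, mul_comm]
      exact h
    rw [radialSpinor, hM _ (hlog.trans_le (le_abs_self _)), zero_div, zero_smul]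

theorem hasFDerivAt_norm_of_ne_zero {x : Space3} (hx : x ≠ 0) :
    HasFDerivAt (fun y : Space3 => ‖y‖) (‖x‖⁻¹ • innerSL ℝ x) x := by
  have h := (hasStrictFDerivAt_norm_sq x).hasFDerivAt.sqrt (by simpa using hx)
  simp only [Real.sqrt_sq (norm_nonneg _)] at h
  refine h.congr_fderiv ?_
  have : ‖x‖ ≠ 0 := norm_ne_zero_iff.2 hx
  ext v
  simp
  field_simp

theorem partialD_radialSpinor (hR : 0 < R) (hφ : Differentiable ℝ φ) {x : Space3} (hx : x ≠ 0)
    (j : Fin 3) :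
    partialD j (radialSpinor R φ) x =
      ((deriv φ (Real.log (‖x‖ / R)) - φ (Real.log (‖x‖ / R))) / ‖x‖ ^ 3 * x j) •
        EuclideanSpace.single 0 (1 : ℂ) := by
  have hxp : 0 < ‖x‖ := norm_pos_iff.2 hx
  have h1 : HasDerivAt (fun r => φ (Real.log (r / R)) / r) _ ‖x‖ :=
    ((hφ _).hasDerivAt.comp ‖x‖ (hasDerivAt_log_div hR hxp)).fun_div (hasDerivAt_id ‖x‖) hxp.ne'
  have h2 := h1.comp_hasFDerivAt x (hasFDerivAt_norm_of_ne_zero hx)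
  have h3 : HasFDerivAt (radialSpinor R φ) _ x :=
    h2.smul_const (EuclideanSpace.single 0 (1 : ℂ) : Spinor)
  rw [partialD, h3.fderiv]
  simp only [ContinuousLinearMap.smulRight_apply, _root_.smul_apply,
    innerSL_apply_apply, EuclideanSpace.inner_single_right, smul_eq_mul]
  congr 1
  simp
  field_simp

/-- All partial derivatives are real multiples of one fixed spinor, so the antisymmetric spin terms
vanish. -/
theorem kineticDensity_radialSpinor (hR : 0 < R) (hφ : Differentiable ℝ φ) (x : Space3) :
    kineticDensity (radialSpinor R φ) x =
      (deriv φ (Real.log (‖x‖ / R)) - φ (Real.log (‖x‖ / R))) ^ 2 / ‖x‖ ^ 3 := by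
  rcases eq_or_ne x 0 with rfl | hx
  · simp [kineticDensity]
  have hxp : 0 < ‖x‖ := norm_pos_iff.2 hx
  rw [kineticDensity, norm_sq_diracOp]
  simp only [partialD_radialSpinor hR hφ hx, spinForm_smul_left, spinForm_smul_right,
    spinForm_self, mul_zero, Finset.sum_const_zero, add_zero, norm_smul, mul_pow,
    Real.norm_eq_abs, sq_abs, ← Finset.mul_sum, ← Finset.sum_mul]
  rw [← EuclideanSpace.real_norm_sq_eq]
  simp
  field_simp

theorem coulombDensity_radialSpinor (x : Space3) :
    coulombDensity (radialSpinor R φ) x = φ (Real.log (‖x‖ / R)) ^ 2 / ‖x‖ ^ 3 := by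
  rcases eq_or_ne x 0 with rfl | hx
  · simp [coulombDensity]
  have hxp : 0 < ‖x‖ := norm_pos_iff.2 hx
  rw [coulombDensity, radialSpinor, norm_smul, mul_pow, Real.norm_eq_abs, sq_abs]
  simp
  field_simp

/-- The condition `φ(0) = 0` makes the spinor vanish on `|x| = R`, which removes the subtracted
term. -/
theorem logDensity_radialSpinor (hR : 0 < R) (h0 : φ 0 = 0) (x : Space3) :
    logDensity R (radialSpinor R φ) x =
      φ (Real.log (‖x‖ / R)) ^ 2 / Real.log (‖x‖ / R) ^ 2 / ‖x‖ ^ 3 := by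
  rcases eq_or_ne x 0 with rfl | hx
  · simp [logDensity]
  have hxp : 0 < ‖x‖ := norm_pos_iff.2 hx
  have hn : ‖(R / ‖x‖) • x‖ = R := by
    rw [norm_smul, norm_div, norm_norm, Real.norm_of_nonneg hR.le, div_mul_cancel₀ _ hxp.ne']
  have hz : radialSpinor R φ ((R / ‖x‖) • x) = 0 := by
    rw [radialSpinor, hn, div_self hR.ne', Real.log_one, h0, zero_div, zero_smul]
  rw [logDensity, hz, smul_zero, sub_zero, radialSpinor, norm_smul, mul_pow, Real.norm_eq_abs,
    sq_abs]
  simp only [PiLp.norm_single, norm_one, one_pow, mul_one, div_pow]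
  rw [div_div, div_div]
  congr 1
  ring

theorem integral_coulombDensity_radialSpinor (hR : 0 < R) :
    ∫ x, coulombDensity (radialSpinor R φ) x = sphereArea * ∫ t, φ t ^ 2 := by
  simp only [coulombDensity_radialSpinor]
  exact integral_comp_log_norm hR fun t => φ t ^ 2

theorem integral_logDensity_radialSpinor (hR : 0 < R) (h0 : φ 0 = 0) :
    ∫ x, logDensity R (radialSpinor R φ) x = sphereArea * ∫ t, φ t ^ 2 / t ^ 2 := by
  simp only [logDensity_radialSpinor hR h0]
  exact integral_comp_log_norm hR fun t => φ t ^ 2 / t ^ 2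

theorem integral_mul_deriv_eq_zero (hφ : ContDiff ℝ 1 φ) (hc : HasCompactSupport φ) :
    ∫ t, φ t * deriv φ t = 0 := by
  have hd : ∀ t, HasDerivAt (fun s => φ s ^ 2) (2 * (φ t * deriv φ t)) t := fun t => by
    have := ((hφ.differentiable one_ne_zero t).hasDerivAt).fun_pow 2
    refine this.congr_deriv ?_
    push_cast
    ring
  have hcont : Continuous fun t => φ t * deriv φ t :=
    hφ.continuous.mul (hφ.continuous_deriv le_rfl)
  have hi : Integrable fun t => φ t * deriv φ t :=
    hcont.integrable_of_hasCompactSupport hc.mul_right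
  have hi2 : Integrable fun t => φ t ^ 2 :=
    (hφ.continuous.pow 2).integrable_of_hasCompactSupport (hasCompactSupport_sq hc)
  have := integral_eq_zero_of_hasDerivAt_of_integrable hd (hi.const_mul 2) hi2
  rw [integral_const_mul] at this
  linarith

/-- The cross term is a multiple of the exact derivative `(φ²)'`. -/
theorem integral_add_mul_deriv_sq (hφ : ContDiff ℝ 1 φ) (hc : HasCompactSupport φ) (a b : ℝ) :
    ∫ t, (a * deriv φ t + b * φ t) ^ 2 =
      a ^ 2 * (∫ t, deriv φ t ^ 2) + b ^ 2 * ∫ t, φ t ^ 2 := by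
  have hd := hφ.continuous_deriv le_rfl
  have hi0 : Integrable fun t => φ t * deriv φ t :=
    (hφ.continuous.mul hd).integrable_of_hasCompactSupport hc.mul_right
  have hi1 : Integrable fun t => φ t ^ 2 :=
    (hφ.continuous.pow 2).integrable_of_hasCompactSupport (hasCompactSupport_sq hc)
  have hi2 : Integrable fun t => deriv φ t ^ 2 :=
    (hd.pow 2).integrable_of_hasCompactSupport (hasCompactSupport_sq hc.deriv)
  have e : ∀ t, (a * deriv φ t + b * φ t) ^ 2 =
      a ^ 2 * deriv φ t ^ 2 + b ^ 2 * φ t ^ 2 + 2 * a * b * (φ t * deriv φ t) := fun t => by ring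
  have hi3 : Integrable fun t => a ^ 2 * deriv φ t ^ 2 + b ^ 2 * φ t ^ 2 :=
    (hi2.const_mul _).add (hi1.const_mul _)
  simp only [e]
  rw [integral_add hi3 (hi0.const_mul _), integral_add (hi2.const_mul _) (hi1.const_mul _),
    integral_const_mul, integral_const_mul, integral_const_mul, integral_mul_deriv_eq_zero hφ hc]
  ring

theorem integral_kineticDensity_radialSpinor (hR : 0 < R) (hφ : ContDiff ℝ 1 φ)
    (hc : HasCompactSupport φ) :
    ∫ x, kineticDensity (radialSpinor R φ) x =
      sphereArea * ((∫ t, deriv φ t ^ 2) + ∫ t, φ t ^ 2) := by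
  have h := integral_add_mul_deriv_sq hφ hc 1 (-1)
  simp only [one_mul, neg_mul, ← sub_eq_add_neg, one_pow, neg_sq] at h
  simp only [kineticDensity_radialSpinor hR (hφ.differentiable one_ne_zero)]
  rw [integral_comp_log_norm hR fun t => (deriv φ t - φ t) ^ 2, h]

end Radial

/-- The support is kept negative so that `h(log t / n)` lives at `t < e^{-n}`, close to 0. -/
theorem exists_bump_neg : ∃ h : ℝ → ℝ, ContDiff ℝ ∞ h ∧ HasCompactSupport h ∧
    (∀ t, h t ≠ 0 → -2 < t ∧ t < -1) ∧ 0 < ∫ t, h t ^ 2 := by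
  let f : ContDiffBump (-(3 / 2) : ℝ) := ⟨1 / 4, 1 / 2, by norm_num, by norm_num⟩
  refine ⟨f, f.contDiff, f.hasCompactSupport, fun t ht => ?_, ?_⟩
  · have h1 : t ∈ Function.support f := ht
    rw [f.support_eq, Real.ball_eq_Ioo] at h1
    have h2 : f.rOut = 1 / 2 := rfl
    rw [h2] at h1
    constructor <;> linarith [h1.1, h1.2]
  · refine Continuous.integral_pos_of_hasCompactSupport_nonneg_nonzero (x := -(3 / 2))
      (f.continuous.pow 2) (hasCompactSupport_sq f.hasCompactSupport)
      (fun t => sq_nonneg _) ?_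
    have : f (-(3 / 2)) = 1 := f.one_of_mem_closedBall (by simp [f.rIn_pos.le])
    simp [this]

/-! ### Sharpness of the constants -/

theorem nonpos_of_forall_nat_mul_le {d X : ℝ} (h : ∀ n : ℕ, 0 < n → d * n ≤ X) : d ≤ 0 := by
  by_contra! hd
  obtain ⟨n, hn⟩ := exists_nat_gt (X / d)
  have h1 := h (n + 1) n.succ_pos
  rw [div_lt_iff₀ hd] at hn
  push_cast at h1
  nlinarith

/-- The constant in front of the Coulomb term is at most `1`. -/
theorem coulomb_constant_le_one {R a b : ℝ} (hR : 0 < R)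
    (hab : ∀ ψ : Space3 → Spinor, IsTestSpinor ψ →
      a * (∫ x, coulombDensity ψ x) + b * ∫ x, logDensity R ψ x ≤ ∫ x, kineticDensity ψ x) :
    a ≤ 1 := by
  obtain ⟨h, hh, hhc, -, hpos⟩ := exists_bump_neg
  have hB : 0 ≤ ∫ t, deriv h t ^ 2 := integral_nonneg fun t => sq_nonneg _
  set A := ∫ t, h t ^ 2
  set B := ∫ t, deriv h t ^ 2
  have hs := sphereArea_pos
  have key : (a - 1) * A ≤ 0 := by
    refine nonpos_of_forall_nat_mul_le (X := (1 + 4 * |b|) * B) fun n hn => ?_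
    have hn1 : (1 : ℝ) ≤ n := by exact_mod_cast hn
    have hn0 : (0 : ℝ) < n := by linarith
    -- Dilation by `n` multiplies `∫ φ²` by `n` and divides `∫ φ'²` by `n`.
    set φ : ℝ → ℝ := fun t => h (t / n)
    have hφ : ContDiff ℝ ∞ φ := hh.comp (contDiff_id.div_const _)
    have hφ1 : ContDiff ℝ 1 φ := hφ.of_le (by norm_cast)
    have hφc : HasCompactSupport φ :=
      hhc.comp_homeomorph (Homeomorph.mulRight₀ (n : ℝ)⁻¹ (inv_ne_zero hn0.ne'))
    have hφd : ∀ t, deriv φ t = deriv h (t / n) / n := fun t => by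
      have h1 := ((hh.differentiable (by simp)) (t / n)).hasDerivAt.comp t
        ((hasDerivAt_id t).div_const (n : ℝ))
      have h2 : HasDerivAt φ _ t := h1
      rw [h2.deriv]
      ring
    have e1 : ∫ t, φ t ^ 2 = n * A := by
      rw [Measure.integral_comp_div (fun t => h t ^ 2) n, abs_of_pos hn0, smul_eq_mul]
    have e2 : ∫ t, deriv φ t ^ 2 = B / n := by
      simp only [hφd, div_pow]
      rw [integral_div, Measure.integral_comp_div (fun t => deriv h t ^ 2) n, abs_of_pos hn0,
        smul_eq_mul]
      change n * B / n ^ 2 = B / n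
      field_simp
    have htest := isTestSpinor_radialSpinor hR hφ hφc
    have hK := integral_kineticDensity_radialSpinor hR hφ1 hφc
    have hC := integral_coulombDensity_radialSpinor (φ := φ) hR
    obtain ⟨-, -, -, hmain⟩ := htest.dirac_hardy hR
    have hineq := hab _ htest
    have hL0 : 0 ≤ ∫ x, logDensity R (radialSpinor R φ) x :=
      integral_nonneg fun x => logDensity_nonneg _ _ _
    set L := ∫ x, logDensity R (radialSpinor R φ) x
    rw [hK, hC, e1, e2] at hineq hmain
    have hBn : B / n ≤ B := div_le_self hB hn1
    -- The inequality already proved bounds the logarithmic term by the excess of kinetic over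
    -- Coulomb, so `bL` stays bounded in `n` whatever the sign of `b`.
    have hL : L ≤ 4 * (sphereArea * B) := by nlinarith
    have hbL : -(|b| * (4 * (sphereArea * B))) ≤ b * L := by
      have h1 : -|b| * L ≤ b * L := mul_le_mul_of_nonneg_right (neg_abs_le b) hL0
      have h2 : |b| * L ≤ |b| * (4 * (sphereArea * B)) :=
        mul_le_mul_of_nonneg_left hL (abs_nonneg b)
      linarith
    refine le_of_mul_le_mul_left ?_ hs
    have h3 : sphereArea * (B / n) ≤ sphereArea * B := mul_le_mul_of_nonneg_left hBn hs.le
    linarith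
  by_contra! ha
  have : 0 < (a - 1) * A := mul_pos (by linarith) hpos
  linarith

/-! ### Truncations of `√t`, the virtual extremal of the one-dimensional Hardy inequality -/

section RootProfile

variable {h : ℝ → ℝ} {n : ℕ}

/-- The profile `√t h(log t / n)`. -/
noncomputable def rootProfile (h : ℝ → ℝ) (n : ℕ) (t : ℝ) : ℝ :=
  √t * h (Real.log t / n)

theorem rootProfile_eq_zero_of_nonpos {t : ℝ} (ht : t ≤ 0) : rootProfile h n t = 0 := by
  rw [rootProfile, Real.sqrt_eq_zero_of_nonpos ht, zero_mul]

theorem bounds_of_rootProfile_ne_zero (hn : 0 < n) (hsupp : ∀ t, h t ≠ 0 → -2 < t ∧ t < -1) {t : ℝ}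
    (ht : rootProfile h n t ≠ 0) : Real.exp (-2 * n) < t ∧ t < Real.exp (-n) := by
  have hn0 : (0 : ℝ) < n := by exact_mod_cast hn
  have ht0 : 0 < t := by
    by_contra! h0
    exact ht (rootProfile_eq_zero_of_nonpos h0)
  obtain ⟨h1, h2⟩ := hsupp _ (right_ne_zero_of_mul ht)
  rw [lt_div_iff₀ hn0, Real.lt_log_iff_exp_lt ht0] at h1
  rw [div_lt_iff₀ hn0, Real.log_lt_iff_lt_exp ht0] at h2
  exact ⟨h1, by simpa using h2⟩

theorem rootProfile_eventuallyEq_zero (hn : 0 < n) (hsupp : ∀ t, h t ≠ 0 → -2 < t ∧ t < -1) {t : ℝ}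
    (ht : t ≤ 0) : rootProfile h n =ᶠ[nhds t] fun _ => 0 := by
  filter_upwards [Iio_mem_nhds (ht.trans_lt (Real.exp_pos (-2 * n)))] with s hs
  by_contra hne
  exact lt_asymm hs (bounds_of_rootProfile_ne_zero hn hsupp hne).1

theorem contDiff_rootProfile (hh : ContDiff ℝ ∞ h) (hn : 0 < n)
    (hsupp : ∀ t, h t ≠ 0 → -2 < t ∧ t < -1) : ContDiff ℝ ∞ (rootProfile h n) := by
  rw [contDiff_iff_contDiffAt]
  intro t
  rcases le_or_gt t 0 with ht | ht
  · exact contDiffAt_const.congr_of_eventuallyEq (rootProfile_eventuallyEq_zero hn hsupp ht)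
  · have hl : ContDiffAt ℝ ∞ (fun s => Real.log s / n) t :=
      (contDiffAt_id.log ht.ne').div_const _
    exact (contDiffAt_id.sqrt ht.ne').mul (hh.contDiffAt.comp t hl)

theorem hasCompactSupport_rootProfile (hn : 0 < n) (hsupp : ∀ t, h t ≠ 0 → -2 < t ∧ t < -1) :
    HasCompactSupport (rootProfile h n) :=
  HasCompactSupport.of_support_subset_isCompact
    (isCompact_Icc (a := Real.exp (-2 * n)) (b := Real.exp (-n))) fun _ ht =>
      ⟨(bounds_of_rootProfile_ne_zero hn hsupp ht).1.le,
        (bounds_of_rootProfile_ne_zero hn hsupp ht).2.le⟩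

theorem integral_Ioi_comp_log_div (hn : 0 < n) (F : ℝ → ℝ) :
    ∫ t in Set.Ioi (0 : ℝ), F (Real.log t / n) / t = n * ∫ u, F u := by
  have hn0 : (0 : ℝ) < n := by exact_mod_cast hn
  have h1 := integral_Ioi_comp_log one_pos fun u => F (u / n)
  simp only [div_one] at h1
  rw [h1, Measure.integral_comp_div F n, abs_of_pos hn0, smul_eq_mul]

theorem integral_rootProfile_sq_div_sq (hn : 0 < n) :
    ∫ t, rootProfile h n t ^ 2 / t ^ 2 = n * ∫ u, h u ^ 2 := by
  rw [← integral_Ioi_comp_log_div hn fun u => h u ^ 2,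
    ← setIntegral_eq_integral_of_forall_compl_eq_zero (s := Set.Ioi (0 : ℝ))]
  · refine setIntegral_congr_fun measurableSet_Ioi fun t ht => ?_
    have ht0 : 0 < t := ht
    simp only [rootProfile, mul_pow, Real.sq_sqrt ht0.le]
    field_simp
  · intro t ht
    rw [rootProfile_eq_zero_of_nonpos (not_lt.1 ht)]
    simp

/-- For `t > 0` the derivative is `(h'/n + h/2)/√t` at `u = log t / n`. Substituting `u` gives `n ∫
(h'/n + h/2)²`, whose cross term integrates to 0. -/
theorem integral_deriv_rootProfile_sq (hh : ContDiff ℝ ∞ h) (hhc : HasCompactSupport h)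
    (hn : 0 < n) (hsupp : ∀ t, h t ≠ 0 → -2 < t ∧ t < -1) :
    ∫ t, deriv (rootProfile h n) t ^ 2 =
      n * (1 / 4 * ∫ u, h u ^ 2) + (∫ u, deriv h u ^ 2) / n := by
  have hn0 : (0 : ℝ) < n := by exact_mod_cast hn
  have hh1 : ContDiff ℝ 1 h := hh.of_le (by norm_cast)
  have hsq := integral_add_mul_deriv_sq hh1 hhc (1 / n) (1 / 2)
  have hsub := integral_Ioi_comp_log_div hn fun u => (1 / n * deriv h u + 1 / 2 * h u) ^ 2
  rw [← setIntegral_eq_integral_of_forall_compl_eq_zero (s := Set.Ioi (0 : ℝ))]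
  · trans ∫ t in Set.Ioi (0 : ℝ),
      (1 / n * deriv h (Real.log t / n) + 1 / 2 * h (Real.log t / n)) ^ 2 / t
    · refine setIntegral_congr_fun measurableSet_Ioi fun t ht => ?_
      have ht0 : 0 < t := ht
      have hst : √t ≠ 0 := (Real.sqrt_pos.2 ht0).ne'
      have h1 := ((hh1.differentiable one_ne_zero) (Real.log t / n)).hasDerivAt.comp t
        ((Real.hasDerivAt_log ht0.ne').div_const (n : ℝ))
      have h2 : HasDerivAt (rootProfile h n) _ t := (Real.hasDerivAt_sqrt ht0.ne').mul h1
      have h3 : deriv (rootProfile h n) t =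
          (1 / n * deriv h (Real.log t / n) + 1 / 2 * h (Real.log t / n)) / √t := by
        rw [h2.deriv]
        have hst2 : t = √t ^ 2 := (Real.sq_sqrt ht0.le).symm
        field_simp
        rw [← hst2]
        field_simp
        ring
      simp only [h3, div_pow, Real.sq_sqrt ht0.le]
    · rw [hsub, hsq]
      field_simp
      ring
  · intro t ht
    rw [(rootProfile_eventuallyEq_zero hn hsupp (not_lt.1 ht)).deriv_eq]
    simp

/-- On the support `t < e^{-n} ≤ 1/n`, hence `t² ≤ 1/n`. -/
theorem rootProfile_sq_le (hn : 0 < n) (hsupp : ∀ t, h t ≠ 0 → -2 < t ∧ t < -1) (t : ℝ) :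
    rootProfile h n t ^ 2 ≤ 1 / n * (rootProfile h n t ^ 2 / t ^ 2) := by
  have hn0 : (0 : ℝ) < n := by exact_mod_cast hn
  by_cases hz : rootProfile h n t = 0
  · simp [hz]
  obtain ⟨h1, h2⟩ := bounds_of_rootProfile_ne_zero hn hsupp hz
  have ht0 : 0 < t := (Real.exp_pos _).trans h1
  have ht1 : t * n ≤ 1 := by
    have h3 : (n : ℝ) ≤ Real.exp n := by linarith [Real.add_one_le_exp (n : ℝ)]
    calc t * n ≤ Real.exp (-n) * Real.exp n :=
          mul_le_mul h2.le h3 hn0.le (Real.exp_pos _).le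
      _ = 1 := by rw [← Real.exp_add]; simp
  have hn1 : (1 : ℝ) ≤ n := by exact_mod_cast hn
  have ht2 : t ^ 2 * n ≤ 1 := by nlinarith
  rw [← mul_div_assoc, le_div_iff₀ (by positivity), div_mul_eq_mul_div, one_mul,
    le_div_iff₀ hn0, mul_assoc]
  exact mul_le_of_le_one_right (sq_nonneg _) ht2

end RootProfile

/-- The constant in front of the logarithmic term is at most `1 / 4`. -/
theorem log_constant_le_quarter {R a b : ℝ} (hR : 0 < R)
    (hab : ∀ ψ : Space3 → Spinor, IsTestSpinor ψ →
      a * (∫ x, coulombDensity ψ x) + b * ∫ x, logDensity R ψ x ≤ ∫ x, kineticDensity ψ x) :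
    b ≤ 1 / 4 := by
  obtain ⟨h, hh, hhc, hsupp, hpos⟩ := exists_bump_neg
  have hB : 0 ≤ ∫ t, deriv h t ^ 2 := integral_nonneg fun t => sq_nonneg _
  have hs := sphereArea_pos
  have key : (b - 1 / 4) * (∫ t, h t ^ 2) ≤ 0 := by
    refine nonpos_of_forall_nat_mul_le
      (X := |1 - a| * (∫ t, h t ^ 2) + ∫ t, deriv h t ^ 2) fun n hn => ?_
    have hn1 : (1 : ℝ) ≤ n := by exact_mod_cast hn
    have hn0 : (0 : ℝ) < n := by linarith
    have hφ := contDiff_rootProfile hh hn hsupp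
    have hφc := hasCompactSupport_rootProfile hn hsupp
    have h0 : rootProfile h n 0 = 0 := rootProfile_eq_zero_of_nonpos le_rfl
    have htest := isTestSpinor_radialSpinor hR hφ hφc
    have hK := integral_kineticDensity_radialSpinor hR (hφ.of_le (by norm_cast)) hφc
    have hC := integral_coulombDensity_radialSpinor (φ := rootProfile h n) hR
    have hL := integral_logDensity_radialSpinor hR h0
    obtain ⟨-, hic, hil, -⟩ := htest.dirac_hardy hR
    have hineq := hab _ htest
    have hC0 : 0 ≤ ∫ x, coulombDensity (radialSpinor R (rootProfile h n)) x :=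
      integral_nonneg fun x => coulombDensity_nonneg _ _
    -- The logarithmic term grows like `n`, so this keeps the Coulomb term bounded; `a` then plays
    -- no role as `n` grows.
    have hCL : ∫ x, coulombDensity (radialSpinor R (rootProfile h n)) x ≤
        1 / n * ∫ x, logDensity R (radialSpinor R (rootProfile h n)) x := by
      rw [← integral_const_mul]
      refine integral_mono hic (hil.const_mul _) fun x => ?_
      simp only [coulombDensity_radialSpinor, logDensity_radialSpinor hR h0]
      rw [← mul_div_assoc]
      exact div_le_div_of_nonneg_right (rootProfile_sq_le hn hsupp _) (by positivity)
    rw [integral_rootProfile_sq_div_sq hn] at hL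
    rw [integral_deriv_rootProfile_sq hh hhc hn hsupp, mul_add, ← hC] at hK
    rw [hK, hL] at hineq
    rw [hL] at hCL
    set A := ∫ t, h t ^ 2
    set B := ∫ t, deriv h t ^ 2
    set C := ∫ x, coulombDensity (radialSpinor R (rootProfile h n)) x
    have hCA : C ≤ sphereArea * A := by
      refine hCL.trans (le_of_eq ?_)
      field_simp
    have hBn : B / n ≤ B := div_le_self hB hn1
    have h1 : (1 - a) * C ≤ |1 - a| * (sphereArea * A) :=
      (mul_le_mul_of_nonneg_right (le_abs_self _) hC0).trans
        (mul_le_mul_of_nonneg_left hCA (abs_nonneg _))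
    have h2 : sphereArea * (B / n) ≤ sphereArea * B := mul_le_mul_of_nonneg_left hBn hs.le
    refine le_of_mul_le_mul_left ?_ hs
    linarith
  by_contra! hb
  have : 0 < (b - 1 / 4) * ∫ t, h t ^ 2 := mul_pos (by linarith) hpos
  linarith

theorem lemma1p13 (R : ℝ) (hR : 0 < R) :
    (∀ ψ : Space3 → Spinor, IsTestSpinor ψ →
      Integrable (kineticDensity ψ) ∧ Integrable (coulombDensity ψ) ∧
      Integrable (logDensity R ψ) ∧
      (∫ x, coulombDensity ψ x) + (1 / 4 : ℝ) * ∫ x, logDensity R ψ x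
        ≤ ∫ x, kineticDensity ψ x) ∧
    (∀ a b : ℝ,
      (∀ ψ : Space3 → Spinor, IsTestSpinor ψ →
        a * (∫ x, coulombDensity ψ x) + b * ∫ x, logDensity R ψ x
          ≤ ∫ x, kineticDensity ψ x) →
      a ≤ 1 ∧ b ≤ 1 / 4) :=
  ⟨fun _ hψ => hψ.dirac_hardy hR,
    fun _ _ hab => ⟨coulomb_constant_le_one hR hab, log_constant_le_quarter hR hab⟩⟩
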